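/- A unary deterministic pushdown automaton (UDPDA) consists of finite sets $Q$ of states and $\Gamma$ of stack symbols, an initial state $q_0\in Q$, an initial stack symbol $Z_0\in\Gamma$, the one-letter input alphabet $\Sigma=\{a\}$, and a finite set $\delta\subseteq Q\times\Gamma\times(\Sigma\cup\{\varepsilon\})\times Q\times\Gamma^*$ of actions such that (i) for all $q\in Q$, $X\in\Gamma$, $b\in\Sigma\cup\{\varepsilon\}$ there is at most one $(q',\beta)$ with $(q,X,b,q',\beta)\in\delta$, and (ii) if there is such an action for $q,X$ and $b=\varepsilon$, then there is none for $q,X$ and $b=a$. An action $(q,X,b,q',\beta)$ permits the moves from $(q,X\gamma)$ to $(q',\beta\gamma)$, $\gamma\in\Gamma^*$, which consume $b$; the automaton accepts by empty stack, that is, its language is the set of words $w\in\Sigma^*$ consumed by some finite sequence of moves from $(q_0,Z_0)$ to some $(q,\varepsilon)$ with $q\in Q$. Theorem. There is a polynomial-time algorithm which, given any UDPDA $P$, with $n$ states and $p$ stack symbols, computes a context-free grammar with at most $np$ variables (the start variable included) that generates the language of $P$. Here $P$ and the grammar are written down explicitly as words over a fixed finite alphabet (with states, stack symbols and variables as numbers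 in unary), and the running time of the algorithm, a multi-stack Turing machine, is bounded by a polynomial in the length of the description of $P$. -/

import Mathlib

/-- An action `(source, pop) ↪_read (target, push)` of a pushdown automaton with states `Q`, input
alphabet `T` and stack alphabet `Γ`; `read = none` stands for the empty word `ε`. -/
structure PDAAction (Q T Γ : Type) where
  source : Q
  pop : Γ
  read : Option T
  target : Q
  push : List Γ
deriving DecidableEq

/-- A pushdown automaton (acceptance is by empty stack). -/
structure PDA (Q T Γ : Type) where
  actions : Finset (PDAAction Q T Γ)
  initState : Q
  initSymbol : Γ

namespace PDA

variable {Q T Γ : Type}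

/-- `P.Move I b J`: the move `I ⊢_b J` between instantaneous descriptions, i.e. pairs of a state
and a stack content whose first letter is the top of the stack. -/
def Move (P : PDA Q T Γ) (I : Q × List Γ) (b : Option T) (J : Q × List Γ) : Prop :=
  ∃ a ∈ P.actions, ∃ γ : List Γ,
    a.read = b ∧ I = (a.source, a.pop :: γ) ∧ J = (a.target, a.push ++ γ)

/-- `P.MoveSeq I w J`: there is a finite move sequence from `I` to `J` consuming the word `w`. -/
inductive MoveSeq (P : PDA Q T Γ) : Q × List Γ → List T → Q × List Γ → Prop
  | refl (I : Q × List Γ) : MoveSeq P I [] I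
  | step {I K J : Q × List Γ} {b : Option T} {w : List T} :
      P.Move I b K → MoveSeq P K w J → MoveSeq P I (b.toList ++ w) J

/-- The language accepted by empty stack. -/
def language (P : PDA Q T Γ) : Language T :=
  {w | ∃ q : Q, P.MoveSeq (P.initState, [P.initSymbol]) w (q, [])}

/-- Determinism: (i) there is at most one action for each state `q`, each `b ∈ T ∪ {ε}` and each
stack symbol `X`; (ii) if there is an `ε`-action for `q` and `X`, then there is no action for `q`
and `X` that reads a letter. -/
def IsDeterministic (P : PDA Q T Γ) : Prop :=
  (∀ a ∈ P.actions, ∀ a' ∈ P.actions,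
    a.source = a'.source → a.pop = a'.pop → a.read = a'.read → a = a') ∧
  (∀ a ∈ P.actions, ∀ a' ∈ P.actions,
    a.source = a'.source → a.pop = a'.pop → a.read = none → a'.read = none)

end PDA

/-- A unary deterministic pushdown automaton, presented as the input of an algorithm: the states
are `0, …, numStates - 1`, the stack symbols are `0, …, numSymbols - 1`, the only input letter is
the element of `Unit`, and the set of actions is given by a list. -/
structure UDPDA where
  numStates : ℕ
  numSymbols : ℕ
  initState : Fin numStates
  initSymbol : Fin numSymbols
  actions : List (PDAAction (Fin numStates) Unit (Fin numSymbols))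
  deterministic : PDA.IsDeterministic ⟨actions.toFinset, initState, initSymbol⟩

/-- The pushdown automaton that is presented. -/
def UDPDA.toPDA (P : UDPDA) : PDA (Fin P.numStates) Unit (Fin P.numSymbols) :=
  ⟨P.actions.toFinset, P.initState, P.initSymbol⟩

/-- A context-free grammar over a one-letter alphabet, presented as the output of an algorithm: the
variables are `0, …, numVars - 1` and the set of rules is given by a list. -/
structure UnaryCFG where
  numVars : ℕ
  start : Fin numVars
  rules : List (ContextFreeRule Unit (Fin numVars))

/-- The context-free grammar that is presented. -/
def UnaryCFG.toCFG (G : UnaryCFG) : ContextFreeGrammar Unit :=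
  ⟨Fin G.numVars, G.start, G.rules.toFinset⟩

/-- The letters used to write down automata and grammars. -/
inductive Letter
  | one
  | comma
  | semi
deriving DecidableEq

/-- Encoding of a finite sequence of finite sequences of natural numbers: numbers are written in
unary and closed by a comma, and every sequence of numbers is closed by a semicolon. -/
def encodeTable (t : List (List ℕ)) : List Letter :=
  t.flatMap fun l => (l.flatMap fun k => List.replicate k Letter.one ++ [Letter.comma]) ++
    [Letter.semi]

/-- The table of a unary deterministic pushdown automaton: a header, followed by one row for each
action. -/
def UDPDA.table (P : UDPDA) : List (List ℕ) :=
  [P.numStates, P.numSymbols, P.initState, P.initSymbol] ::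
    P.actions.map fun a =>
      (a.source : ℕ) :: (a.pop : ℕ) :: a.read.toList.length :: (a.target : ℕ) ::
        a.push.map Fin.val

/-- A symbol on the right-hand side of a rule as a number: `0` is the letter of the alphabet, and
`i + 1` is the variable `i`. -/
def symbolCode {m : ℕ} : Symbol Unit (Fin m) → ℕ
  | Symbol.terminal _ => 0
  | Symbol.nonterminal i => i + 1

/-- The table of a grammar: a header, followed by one row for each rule. -/
def UnaryCFG.table (G : UnaryCFG) : List (List ℕ) :=
  [G.numVars, (G.start : ℕ)] ::
    G.rules.map fun r => (r.input : ℕ) :: r.output.map symbolCode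

/-- The input word that describes a unary deterministic pushdown automaton. -/
def UDPDA.encode (P : UDPDA) : List Letter := encodeTable P.table

/-- The output word that describes a grammar. -/
def UnaryCFG.encode (G : UnaryCFG) : List Letter := encodeTable G.table

/-- Different tables are written differently. -/
theorem encodeTable_injective : Function.Injective encodeTable := by
  have h1 : ∀ (k k' : ℕ) (u v : List Letter),
      List.replicate k Letter.one ++ Letter.comma :: u =
        List.replicate k' Letter.one ++ Letter.comma :: v → k = k' ∧ u = v := by
    intro k
    induction k with
    | zero => intro k' u v h; cases k' <;> simp_all [List.replicate_succ]
    | succ k ih =>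
      intro k' u v h
      cases k' with
      | zero => simp [List.replicate_succ] at h
      | succ k' =>
        simp only [List.replicate_succ, List.cons_append, List.cons.injEq, true_and] at h
        simpa using ih k' u v h
  have h2 : ∀ (k : ℕ) (u v : List Letter),
      List.replicate k Letter.one ++ Letter.comma :: u ≠ Letter.semi :: v := by
    intro k u v h
    cases k <;> simp [List.replicate_succ] at h
  have h3 : ∀ (l l' : List ℕ) (u v : List Letter),
      (l.flatMap fun k => List.replicate k Letter.one ++ [Letter.comma]) ++ Letter.semi :: u =
      (l'.flatMap fun k => List.replicate k Letter.one ++ [Letter.comma]) ++ Letter.semi :: v →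
        l = l' ∧ u = v := by
    intro l
    induction l with
    | nil =>
      intro l' u v h
      cases l' with
      | nil => simpa using h
      | cons k' l' =>
        simp only [List.flatMap_nil, List.nil_append, List.flatMap_cons, List.append_assoc,
          List.cons_append] at h
        exact absurd h.symm (h2 _ _ _)
    | cons k l ih =>
      intro l' u v h
      cases l' with
      | nil =>
        simp only [List.flatMap_nil, List.nil_append, List.flatMap_cons, List.append_assoc,
          List.cons_append] at h
        exact absurd h (h2 _ _ _)
      | cons k' l' =>
        simp only [List.nil_append, List.flatMap_cons, List.append_assoc,
          List.cons_append] at h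
        obtain ⟨rfl, hl⟩ := h1 _ _ _ _ h
        obtain ⟨rfl, rfl⟩ := ih _ _ _ hl
        exact ⟨rfl, rfl⟩
  intro t
  induction t with
  | nil =>
    intro t' h
    cases t' with
    | nil => rfl
    | cons l' t' => simp [encodeTable] at h
  | cons l t ih =>
    intro t' h
    cases t' with
    | nil => simp [encodeTable] at h
    | cons l' t' =>
      simp only [encodeTable, List.flatMap_cons, List.append_assoc, List.cons_append,
        List.nil_append] at h
      obtain ⟨rfl, ht⟩ := h3 _ _ _ _ h
      rw [ih ht]

/-- Different automata have different descriptions. -/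
theorem UDPDA.encode_injective : Function.Injective UDPDA.encode := by
  rintro ⟨n, p, q, X, δ, d⟩ ⟨n', p', q', X', δ', d'⟩ h
  have ht := encodeTable_injective h
  simp only [UDPDA.table, List.cons.injEq, and_true] at ht
  obtain ⟨⟨rfl, rfl, hq, hX⟩, ha⟩ := ht
  obtain rfl := Fin.ext hq
  obtain rfl := Fin.ext hX
  have : δ = δ' := by
    refine List.map_injective_iff.2 ?_ ha
    rintro ⟨s, Y, b, t, β⟩ ⟨s', Y', b', t', β'⟩ e
    simp only [List.cons.injEq] at e
    obtain ⟨h1, h2, h3, h4, h5⟩ := e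
    obtain rfl := Fin.ext h1
    obtain rfl := Fin.ext h2
    obtain rfl := Fin.ext h4
    obtain rfl := List.map_injective_iff.2 Fin.val_injective h5
    cases b <;> cases b' <;> simp_all
  subst this
  rfl

/-- Different grammars have different descriptions. -/
theorem UnaryCFG.encode_injective : Function.Injective UnaryCFG.encode := by
  rintro ⟨n, s, R⟩ ⟨n', s', R'⟩ h
  have ht := encodeTable_injective h
  simp only [UnaryCFG.table, List.cons.injEq, and_true] at ht
  obtain ⟨⟨rfl, hs⟩, ha⟩ := ht
  obtain rfl := Fin.ext hs
  have : R = R' := by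
    refine List.map_injective_iff.2 ?_ ha
    rintro ⟨A, o⟩ ⟨A', o'⟩ e
    simp only [List.cons.injEq] at e
    obtain ⟨h1, h2⟩ := e
    obtain rfl := Fin.ext h1
    have : Function.Injective (symbolCode (m := n)) := by
      rintro (a | a) (b | b) e
      · rfl
      · simp [symbolCode] at e
      · simp [symbolCode] at e
      · simp only [symbolCode, Nat.add_right_cancel_iff] at e
        rw [Fin.ext e]
    obtain rfl := List.map_injective_iff.2 this h2
    rfl
  subst this
  rfl

/-!
A unary deterministic automaton has at most one action for each pair `(q, X)` of a state and a stack
symbol, so that its computation is unique. In particular, if `X` can be popped from `q` at all, then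
the state `s` in which this happens depends on `(q, X)` only. A table `t` with `t (q, X) = s` for all
such pairs allows one to replace the usual variables `(q, X, s)` of the triple construction by
`(q, X)`: each action yields one rule, `(q, X) → b (r₀, Y₁) (r₁, Y₂) …` with
`rᵢ = t (rᵢ₋₁, Yᵢ)`. The entries of `t` at pairs that are never popped are irrelevant, because the
corresponding variables generate nothing (`PDA.language_eq_of_rules`).

The table is computed by iteration: starting with an arbitrary table, each round updates, for each
action in turn, the entry for the source of the action by evaluating the pushed word in the current
table. If the pairs that can be popped are ranked by the number of moves that this takes, each round
makes one more rank correct, and so as many rounds as there are pairs suffice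
(`PDA.isCorrect_iterate_tableRound`). Entries that are correct stay correct, and so the rules may be
written during one further round.

For the running time, `StackProg` is a small language of loop programs on stacks, which compiles to
Turing machines with several stacks. Its semantics `StackProg.Runs` bounds all loops by one number
`B`; then the running time is a polynomial in `B` that can be read off the program
(`StackProg.Runs.stepsIn`), and `StackProg.polyTime_of_runs` asks only for a polynomial `B`. The
program `UDPDAConverter.convertProg` carries out the rounds. It keeps the table as the list of its
entries, in unary and in the order of the numbers `X + p * q` of the pairs, so that looking up an
entry amounts to passing over as many entries as the number of the variable says, and the variable
is written at the same time.
-/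

/-! ### Structured programs on stacks -/

/-- Structured programs acting on stacks which are indexed by `K` and have letters in `A`. There
are no variables besides the stacks; `loop k t c` repeats `c` as long as the top of the stack `k`
(`none` if `k` is empty) passes the test `t`. -/
inductive StackProg (K A : Type) : Type
  | push (k : K) (a : A)
  | pop (k : K)
  | move (k k' : K)
  | seq (c d : StackProg K A)
  | loop (k : K) (t : Option A → Bool) (c : StackProg K A)

/-- Sequential composition of programs. -/
infixr:60 " ;; " => StackProg.seq

namespace StackProg

variable {K A : Type}

/-- `LoopRuns R C n S S'`: iterating the relation `R` exactly `n` times leads from `S` to `S'`,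
where `C` holds before each iteration and fails in the end. -/
def LoopRuns {α : Type} (R : α → α → Prop) (C : α → Prop) : ℕ → α → α → Prop
  | 0, S, S' => ¬ C S ∧ S = S'
  | n + 1, S, S' => C S ∧ ∃ M, R S M ∧ LoopRuns R C n M S'

/-- `c.Runs B S S'`: the program `c` turns the stack contents `S` into `S'`, and each execution of
a loop on the way takes at most `B` iterations. Bounding all loops by one number leaves the running
time to the syntax of the program, see `StackProg.cost`. -/
def Runs [DecidableEq K] (B : ℕ) : StackProg K A → (K → List A) → (K → List A) → Prop
  | push k a, S, S' => S' = Function.update S k (a :: S k)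
  | pop k, S, S' => S' = Function.update S k (S k).tail
  | move k k', S, S' => ∃ a l, S k = a :: l ∧
      S' = Function.update (Function.update S k l) k' (a :: Function.update S k l k')
  | seq c d, S, S' => ∃ M, Runs B c S M ∧ Runs B d M S'
  | loop k t c, S, S' => ∃ n ≤ B, LoopRuns (Runs B c) (fun S => t (S k).head? = true) n S S'

/-- The labels of the Turing machine for a program: one for each instruction. -/
def Lbl : StackProg K A → Type
  | push _ _ => Unit
  | pop _ => Unit
  | move _ _ => Unit
  | seq c d => c.Lbl ⊕ d.Lbl
  | loop _ _ c => Option c.Lbl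

/-- A program has finitely many labels. -/
@[reducible]
def lblFintype : (c : StackProg K A) → Fintype c.Lbl
  | push _ _ => inferInstanceAs (Fintype Unit)
  | pop _ => inferInstanceAs (Fintype Unit)
  | move _ _ => inferInstanceAs (Fintype Unit)
  | seq c d =>
    letI := c.lblFintype
    letI := d.lblFintype
    inferInstanceAs (Fintype (c.Lbl ⊕ d.Lbl))
  | loop _ _ c =>
    letI := c.lblFintype
    inferInstanceAs (Fintype (Option c.Lbl))

instance (c : StackProg K A) : Fintype c.Lbl := c.lblFintype

/-- The label at which the execution of a program starts. -/
def entry : (c : StackProg K A) → c.Lbl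
  | push _ _ => ()
  | pop _ => ()
  | move _ _ => ()
  | seq c _ => Sum.inl c.entry
  | loop _ _ _ => none

/-- The statements of the Turing machine for a program that is part of a larger one with labels
`Λ`: `emb` embeds the labels, and `exit` is the label at which the execution goes on. The internal
state is a buffer for the letter read last. -/
def compile [Inhabited A] {Λ : Type} :
    (c : StackProg K A) → (c.Lbl → Λ) → Λ → c.Lbl → Turing.TM2.Stmt (fun _ : K => A) Λ (Option A)
  | push k a, _, exit, _ => .push k (fun _ => a) (.goto fun _ => exit)
  | pop k, _, exit, _ => .pop k (fun v _ => v) (.goto fun _ => exit)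
  | move k k', _, exit, _ => .pop k (fun _ o => o)
      (.push k' (fun v => v.getD default) (.goto fun _ => exit))
  | seq c d, emb, exit, l =>
      Sum.elim (compile c (fun l => emb (Sum.inl l)) (emb (Sum.inr d.entry)))
        (compile d (fun l => emb (Sum.inr l)) exit) l
  | loop k t c, emb, exit, l =>
      Option.elim l
        (.peek k (fun _ o => o)
          (.branch t (.goto fun _ => emb (some c.entry)) (.goto fun _ => exit)))
        (compile c (fun l => emb (some l)) (emb none))

/-- A bound for the number of steps of the machine for a program, as a polynomial in the bound for
the number of iterations of its loops. -/
noncomputable def cost : StackProg K A → Polynomial ℕ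
  | push _ _ => 1
  | pop _ => 1
  | move _ _ => 1
  | seq c d => c.cost + d.cost
  | loop _ _ c => Polynomial.X * (c.cost + 1) + 1

/-- `StepsIn M t C C'`: the machine `M` gets from `C` to `C'` in at most `t` steps. -/
def StepsIn [DecidableEq K] {Λ σ : Type} (M : Λ → Turing.TM2.Stmt (fun _ : K => A) Λ σ) (t : ℕ)
    (C C' : Turing.TM2.Cfg (fun _ : K => A) Λ σ) : Prop :=
  ∃ s ≤ t, (flip bind (Turing.TM2.step M))^[s] (some C) = some C'

section Compile

variable [DecidableEq K] {Λ σ : Type} {M : Λ → Turing.TM2.Stmt (fun _ : K => A) Λ σ}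

theorem StepsIn.single {C C' : Turing.TM2.Cfg (fun _ : K => A) Λ σ}
    (h : Turing.TM2.step M C = some C') : StepsIn M 1 C C' :=
  ⟨1, le_rfl, h⟩

theorem StepsIn.trans {s t : ℕ} {C C' C'' : Turing.TM2.Cfg (fun _ : K => A) Λ σ}
    (h : StepsIn M s C C') (h' : StepsIn M t C' C'') : StepsIn M (s + t) C C'' := by
  obtain ⟨m, hm, e⟩ := h
  obtain ⟨n, hn, e'⟩ := h'
  exact ⟨n + m, by omega, by rw [Function.iterate_add_apply, e, e']⟩

theorem StepsIn.mono {s t : ℕ} {C C' : Turing.TM2.Cfg (fun _ : K => A) Λ σ}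
    (h : StepsIn M s C C') (hst : s ≤ t) : StepsIn M t C C' := by
  obtain ⟨m, hm, e⟩ := h
  exact ⟨m, hm.trans hst, e⟩

end Compile

/-- A machine that contains the statements of a program gets from the entry of the program to its
exit within the time given by `StackProg.cost`. The contents of the buffer are irrelevant. -/
theorem Runs.stepsIn [DecidableEq K] [Inhabited A] {B : ℕ} {Λ : Type}
    {M : Λ → Turing.TM2.Stmt (fun _ : K => A) Λ (Option A)} (c : StackProg K A) :
    ∀ (emb : c.Lbl → Λ) (exit : Λ), (∀ l, M (emb l) = c.compile emb exit l) →
    ∀ {S S' : K → List A}, c.Runs B S S' → ∀ v,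
      ∃ v', StepsIn M (c.cost.eval B) ⟨some (emb c.entry), v, S⟩ ⟨some exit, v', S'⟩ := by
  induction c with
  | push k a =>
    rintro emb exit hM S S' rfl v
    refine ⟨v, ?_⟩
    simp only [cost, Polynomial.eval_one]
    exact .single (by simp [hM, compile])
  | pop k =>
    rintro emb exit hM S S' rfl v
    refine ⟨v, ?_⟩
    simp only [cost, Polynomial.eval_one]
    exact .single (by simp [hM, compile])
  | move k k' =>
    rintro emb exit hM S S' ⟨a, l, h, rfl⟩ v
    refine ⟨some a, ?_⟩
    simp only [cost, Polynomial.eval_one]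
    exact .single (by simp [hM, compile, h])
  | seq c d hc hd =>
    rintro emb exit hM S S' ⟨T, h, h'⟩ v
    obtain ⟨v', s⟩ := hc (fun l => emb (Sum.inl l)) (emb (Sum.inr d.entry))
      (fun l => hM (Sum.inl l)) h v
    obtain ⟨v'', s'⟩ := hd (fun l => emb (Sum.inr l)) exit (fun l => hM (Sum.inr l)) h' v'
    refine ⟨v'', ?_⟩
    simp only [cost, Polynomial.eval_add]
    exact s.trans s'
  | loop k t c hc =>
    rintro emb exit hM S S' ⟨n, hn, h⟩ v
    have hM₀ := hM none
    simp only [compile, Option.elim_none] at hM₀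
    have key : ∀ n S v, LoopRuns (Runs B c) (fun S => t (S k).head? = true) n S S' →
        ∃ v', StepsIn M (n * (c.cost.eval B + 1) + 1) ⟨some (emb none), v, S⟩
          ⟨some exit, v', S'⟩ := by
      intro n
      induction n with
      | zero =>
        rintro S v ⟨hf, rfl⟩
        have hf : t (S k).head? = false := by simpa using hf
        refine ⟨(S k).head?, ?_⟩
        rw [Nat.zero_mul, Nat.zero_add]
        exact .single (by rw [Turing.TM2.step, hM₀]; simp [hf])
      | succ n ih =>
        rintro S v ⟨h, T, hT, hr⟩
        obtain ⟨v', s⟩ := hc (fun l => emb (some l)) (emb none) (fun l => hM (some l)) hT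
          (S k).head?
        obtain ⟨v'', s'⟩ := ih T v' hr
        have s₀ : StepsIn M 1 ⟨some (emb none), v, S⟩
            ⟨some (emb (some c.entry)), (S k).head?, S⟩ :=
          .single (by rw [Turing.TM2.step, hM₀]; simp [h])
        exact ⟨v'', ((s₀.trans s).trans s').mono (by ring_nf; omega)⟩
    obtain ⟨v', s⟩ := key n S v h
    refine ⟨v', s.mono ?_⟩
    simp only [cost, Polynomial.eval_add, Polynomial.eval_mul, Polynomial.eval_X,
      Polynomial.eval_one]
    gcongr

/-- The Turing machine for a program. Besides the labels of the program it has the label `none`,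
where the buffer is emptied and the machine halts. -/
def machine [DecidableEq K] [Fintype K] [Fintype A] [Inhabited A] (c : StackProg K A) (k : K) :
    Turing.FinTM2 where
  K := K
  k₀ := k
  k₁ := k
  Γ := fun _ => A
  Λ := Option c.Lbl
  main := some c.entry
  σ := Option A
  initialState := none
  Γk₀Fin := inferInstanceAs (Fintype A)
  m l := l.elim (.load (fun _ => none) .halt) (c.compile some none)

/-- A function is computable in polynomial time if a program, run with polynomially bounded loops,
replaces the input on one stack by the output while the other stacks are empty. -/
theorem polyTime_of_runs [DecidableEq K] [Fintype K] [Fintype A] [Inhabited A] {α β : Type}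
    {ea : α → List A} {eb : β → List A} {f : α → β} (c : StackProg K A) (k : K)
    (B : Polynomial ℕ)
    (h : ∀ x, c.Runs (B.eval (ea x).length) (Function.update (fun _ => []) k (ea x))
      (Function.update (fun _ => []) k (eb (f x)))) :
    Nonempty (Turing.TM2ComputableInPolyTime ea eb f) := by
  have key : ∀ x, Nonempty (Turing.TM2OutputsInTime (c.machine k) (ea x) (some (eb (f x)))
      ((c.cost.comp B + 1).eval (ea x).length)) := by
    intro x
    obtain ⟨v, s⟩ := Runs.stepsIn (M := (c.machine k).m) c some none (fun l => rfl) (h x) none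
    have s₁ : StepsIn (c.machine k).m 1
        ⟨some none, v, Function.update (fun _ => []) k (eb (f x))⟩
        ⟨none, none, Function.update (fun _ => []) k (eb (f x))⟩ := .single rfl
    obtain ⟨t, ht, e⟩ := s.trans s₁
    have hi : Turing.initList (c.machine k) (ea x) =
        ⟨some (some c.entry), none, Function.update (fun _ => []) k (ea x)⟩ := by
      refine congrArg (Turing.TM2.Cfg.mk _ _) (funext fun k' => ?_)
      by_cases hk : k' = k
      · rw [hk]
        refine (dif_pos rfl).trans ?_
        exact (Function.update_self (β := fun _ : K => List A) k (ea x) (fun _ => [])).symm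
      · refine (dif_neg hk).trans ?_
        exact (Function.update_of_ne (β := fun _ : K => List A) hk (ea x) (fun _ => [])).symm
    have ho : Turing.haltList (c.machine k) (eb (f x)) =
        ⟨none, none, Function.update (fun _ => []) k (eb (f x))⟩ := by
      refine congrArg (Turing.TM2.Cfg.mk _ _) (funext fun k' => ?_)
      by_cases hk : k' = k
      · rw [hk]
        refine (dif_pos rfl).trans ?_
        exact (Function.update_self (β := fun _ : K => List A) k (eb (f x)) (fun _ => [])).symm
      · refine (dif_neg hk).trans ?_
        exact (Function.update_of_ne (β := fun _ : K => List A) hk (eb (f x)) (fun _ => [])).symm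
    refine ⟨⟨⟨t, ?_⟩, ?_⟩⟩
    · rw [hi]
      exact e.trans (congrArg some ho.symm)
    · have hB : (c.cost.comp B + 1).eval (ea x).length =
          c.cost.eval (B.eval (ea x).length) + 1 := by simp
      exact ht.trans hB.ge
  exact ⟨{ tm := c.machine k
           inputAlphabet := Equiv.refl _
           outputAlphabet := Equiv.refl _
           time := c.cost.comp B + 1
           outputsFun := fun x => by
            have h₁ := List.map_id (ea x)
            have h₂ := List.map_id (eb (f x))
            exact h₁.symm ▸ h₂.symm ▸ (key x).some }⟩

end StackProg

/-! ### Popping computations -/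

namespace PDA

variable {Q T Γ : Type}

/-- `P.Pops m q β w s`: there is a computation of `m` moves from `(q, β)` to `(s, [])` that consumes
`w`, presented as a tree: the first symbol of `β` is popped for good before the others are
touched. -/
inductive Pops (P : PDA Q T Γ) : ℕ → Q → List Γ → List T → Q → Prop
  | nil (q : Q) : Pops P 0 q [] [] q
  | cons {m m' : ℕ} {a : PDAAction Q T Γ} {β : List Γ} {u v : List T} {r s : Q} :
      a ∈ P.actions → Pops P m a.target a.push u r → Pops P m' r β v s →
      Pops P (m + m' + 1) a.source (a.pop :: β) (a.read.toList ++ u ++ v) s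

/-- `P.AtMostOneAction`: no two actions have the same state and the same stack symbol. -/
def AtMostOneAction (P : PDA Q T Γ) : Prop :=
  ∀ a ∈ P.actions, ∀ a' ∈ P.actions, a.source = a'.source → a.pop = a'.pop → a = a'

/-- Over a one-letter alphabet, determinism leaves no choice at all, not even by the input. -/
theorem IsDeterministic.atMostOneAction {P : PDA Q Unit Γ} (h : P.IsDeterministic) :
    P.AtMostOneAction := by
  intro a ha a' ha' hs hp
  refine h.1 a ha a' ha' hs hp ?_
  rcases hr : a.read with - | x
  · exact (h.2 a ha a' ha' hs hp hr).symm
  · rcases hr' : a'.read with - | x'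
    · simp [h.2 a' ha' a ha hs.symm hp.symm hr'] at hr
    · rfl

variable {P : PDA Q T Γ}

theorem Pops.append {m m' : ℕ} {q r s : Q} {β γ : List Γ} {u v : List T}
    (h : P.Pops m q β u r) (h' : P.Pops m' r γ v s) : ∃ k, P.Pops k q (β ++ γ) (u ++ v) s := by
  induction h with
  | nil q => exact ⟨m', h'⟩
  | cons ha h₁ _ _ ih =>
    obtain ⟨k, hk⟩ := ih h'
    have h₂ := Pops.cons ha h₁ hk
    exact ⟨_, by simpa only [List.cons_append, List.append_assoc] using h₂⟩

/-- When a word of stack symbols is popped, a prefix of it is popped first. -/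
theorem Pops.split {m : ℕ} {q s : Q} {β γ δ : List Γ} {w : List T} (h : P.Pops m q δ w s)
    (hδ : δ = β ++ γ) :
    ∃ k k' r u v, w = u ++ v ∧ P.Pops k q β u r ∧ P.Pops k' r γ v s := by
  induction h generalizing β with
  | nil q =>
    obtain ⟨rfl, rfl⟩ := List.append_eq_nil_iff.1 hδ.symm
    exact ⟨0, 0, q, [], [], rfl, .nil q, .nil q⟩
  | @cons m m' a β' u v r s ha h₁ h₂ _ ih =>
    cases β with
    | nil =>
      rw [List.nil_append] at hδ
      subst hδ
      exact ⟨0, _, a.source, [], _, rfl, .nil _, .cons ha h₁ h₂⟩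
    | cons X β =>
      rw [List.cons_append, List.cons.injEq] at hδ
      obtain ⟨rfl, hδ⟩ := hδ
      obtain ⟨k, k', r', u', v', rfl, h₃, h₄⟩ := ih hδ
      exact ⟨_, k', r', _, v', by simp only [List.append_assoc], .cons ha h₁ h₃, h₄⟩

theorem Pops.moveSeq {m : ℕ} {q s : Q} {β : List Γ} {w : List T} (h : P.Pops m q β w s) :
    P.MoveSeq (q, β) w (s, []) := by
  -- further symbols below `β` are not touched
  suffices H : ∀ (γ : List Γ) (v : List T) (J : Q × List Γ), P.MoveSeq (s, γ) v J →
      P.MoveSeq (q, β ++ γ) (w ++ v) J by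
    simpa using H [] [] (s, []) (.refl _)
  induction h with
  | nil q => exact fun γ v J h => h
  | @cons m m' a β u v r s ha h₁ h₂ ih₁ ih₂ =>
    intro γ v' J hJ
    have h₃ := MoveSeq.step ⟨a, ha, β ++ γ, rfl, rfl, rfl⟩ (ih₁ _ _ _ (ih₂ γ v' J hJ))
    simpa only [List.cons_append, List.append_assoc] using h₃

theorem MoveSeq.exists_pops {I J : Q × List Γ} {w : List T} (h : P.MoveSeq I w J)
    (hJ : J.2 = []) : ∃ m, P.Pops m I.1 I.2 w J.1 := by
  induction h with
  | refl I => exact ⟨0, hJ ▸ .nil _⟩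
  | @step I K J b w hm _ ih =>
    obtain ⟨a, ha, γ, rfl, rfl, rfl⟩ := hm
    obtain ⟨m, hm⟩ := ih hJ
    obtain ⟨k, k', r, u, v, rfl, h₁, h₂⟩ := hm.split rfl
    have h₃ := Pops.cons ha h₁ h₂
    exact ⟨_, by simpa only [List.append_assoc] using h₃⟩

theorem mem_language_iff_pops {w : List T} :
    w ∈ P.language ↔ ∃ m s, P.Pops m P.initState [P.initSymbol] w s := by
  constructor
  · rintro ⟨q, h⟩
    obtain ⟨m, hm⟩ := h.exists_pops rfl
    exact ⟨m, q, hm⟩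
  · rintro ⟨m, s, h⟩
    exact ⟨s, h.moveSeq⟩

/-- The number of moves and the final state of a popping computation depend only on its beginning,
not even on the word that is consumed. -/
theorem Pops.unique (hP : P.AtMostOneAction) {m m' : ℕ} {q s s' : Q} {β : List Γ} {w w' : List T}
    (h : P.Pops m q β w s) (h' : P.Pops m' q β w' s') : m = m' ∧ s = s' := by
  induction h generalizing m' w' s' with
  | nil q => cases h'; exact ⟨rfl, rfl⟩
  | @cons m₁ m₂ a β u v r s ha h₁ h₂ ih₁ ih₂ =>
    generalize hq : a.source = q at h'
    generalize hX : a.pop :: β = δ at h'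
    cases h' with
    | nil q => cases hX
    | cons ha' h₁' h₂' =>
      rw [List.cons.injEq] at hX
      obtain ⟨hX, rfl⟩ := hX
      obtain rfl := hP _ ha _ ha' hq hX
      obtain ⟨rfl, rfl⟩ := ih₁ h₁'
      obtain ⟨rfl, rfl⟩ := ih₂ h₂'
      exact ⟨rfl, rfl⟩

/-- Popping a single symbol: the first action and the popping of what it pushes. -/
theorem Pops.exists_action {m : ℕ} {q s : Q} {X : Γ} {w : List T} (h : P.Pops m q [X] w s) :
    ∃ a ∈ P.actions, a.source = q ∧ a.pop = X ∧
      ∃ k u, m = k + 1 ∧ w = a.read.toList ++ u ∧ P.Pops k a.target a.push u s := by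
  generalize hδ : [X] = δ at h
  cases h with
  | nil => cases hδ
  | @cons m m' a β u v r s ha h₁ h₂ =>
    rw [List.cons.injEq] at hδ
    obtain ⟨rfl, rfl⟩ := hδ
    cases h₂
    exact ⟨a, ha, rfl, rfl, m, u, rfl, by simp, h₁⟩

theorem Pops.of_action {a : PDAAction Q T Γ} (ha : a ∈ P.actions) {m : ℕ} {u : List T} {r : Q}
    (h : P.Pops m a.target a.push u r) :
    P.Pops (m + 1) a.source [a.pop] (a.read.toList ++ u) r := by
  simpa using Pops.cons ha h (.nil r)

/-! ### Tables of target states -/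

/-- The state in which the symbols `β` are popped, as predicted by the table `t`, if `q` is the
state in the beginning. -/
def evalTable (t : Q × Γ → Q) (q : Q) : List Γ → Q
  | [] => q
  | X :: β => evalTable t (t (q, X)) β

/-- Update of a table by means of the action `a`. -/
def updateTable [DecidableEq Q] [DecidableEq Γ] (t : Q × Γ → Q) (a : PDAAction Q T Γ) :
    Q × Γ → Q :=
  Function.update t (a.source, a.pop) (evalTable t a.target a.push)

/-- One round of the iteration that computes the table: an update for each action in a list. -/
def tableRound [DecidableEq Q] [DecidableEq Γ] (l : List (PDAAction Q T Γ)) (t : Q × Γ → Q) :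
    Q × Γ → Q :=
  l.foldl updateTable t

/-- A table is correct if it gives the state in which `X` is popped, starting from the state `q`,
whenever `X` can be popped. Its other entries are arbitrary. -/
def IsCorrect (P : PDA Q T Γ) (t : Q × Γ → Q) : Prop :=
  ∀ m q X w s, P.Pops m q [X] w s → t (q, X) = s

theorem evalTable_eq {t : Q × Γ → Q} {m : ℕ} {q s : Q} {β : List Γ} {w : List T}
    (h : P.Pops m q β w s)
    (ht : ∀ k ≤ m, ∀ q X w s, P.Pops k q [X] w s → t (q, X) = s) : evalTable t q β = s := by
  induction h with
  | nil q => rfl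
  | @cons m m' a β u v r s ha h₁ h₂ ih₁ ih₂ =>
    rw [evalTable, ht (m + 1) (by omega) _ _ _ _ (.of_action ha h₁)]
    exact ih₂ fun k hk => ht k (by omega)

section Rank

variable [Fintype Q] [Fintype Γ]

open Classical in
/-- The number of pairs of a state and a stack symbol such that the symbol is popped in less than
`m` moves. -/
noncomputable def rank (P : PDA Q T Γ) (m : ℕ) : ℕ :=
  (Finset.univ.filter fun x : Q × Γ => ∃ k < m, ∃ w s, P.Pops k x.1 [x.2] w s).card

theorem rank_lt (hP : P.AtMostOneAction) {m : ℕ} {q s : Q} {X : Γ} {w : List T}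
    (h : P.Pops m q [X] w s) : P.rank m < Fintype.card Q * Fintype.card Γ := by
  classical
  rw [← Fintype.card_prod, ← Finset.card_univ]
  refine Finset.card_lt_card (Finset.ssubset_univ_iff.2 fun hu => ?_)
  have hx := Finset.mem_univ (q, X)
  rw [← hu, Finset.mem_filter] at hx
  obtain ⟨-, k, hk, w', s', h'⟩ := hx
  exact hk.ne (h'.unique hP h).1

theorem rank_lt_rank (hP : P.AtMostOneAction) {k m : ℕ} (hkm : k < m) {q s : Q} {X : Γ}
    {w : List T} (h : P.Pops k q [X] w s) : P.rank k < P.rank m := by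
  classical
  unfold rank
  refine Finset.card_lt_card ⟨fun x hx => ?_, fun hs => ?_⟩
  · simp only [Finset.mem_filter] at hx ⊢
    obtain ⟨hx, l, hl, hp⟩ := hx
    exact ⟨hx, l, hl.trans hkm, hp⟩
  · have hx := @hs (q, X) (by simpa using ⟨k, hkm, w, s, h⟩)
    simp only [Finset.mem_filter] at hx
    obtain ⟨-, l, hl, w', s', h'⟩ := hx
    exact hl.ne (h'.unique hP h).1

/-- The entries of rank less than `k` of the table are correct. -/
def IsCorrectUpTo (P : PDA Q T Γ) (k : ℕ) (t : Q × Γ → Q) : Prop :=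
  ∀ m q X w s, P.Pops m q [X] w s → P.rank m < k → t (q, X) = s

theorem IsCorrect.upTo {t : Q × Γ → Q} (h : P.IsCorrect t) (k : ℕ) : P.IsCorrectUpTo k t :=
  fun m q X w s hp _ => h m q X w s hp

theorem IsCorrectUpTo.isCorrect (hP : P.AtMostOneAction) {t : Q × Γ → Q}
    (h : P.IsCorrectUpTo (Fintype.card Q * Fintype.card Γ) t) : P.IsCorrect t :=
  fun m q X w s hp => h m q X w s hp (rank_lt hP hp)

variable [DecidableEq Q] [DecidableEq Γ]

/-- The computations that the entry for `a` depends on have a smaller rank, so that an update gives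
one more correct rank at this entry. -/
theorem IsCorrectUpTo.updateTable_self (hP : P.AtMostOneAction) {k : ℕ} {t : Q × Γ → Q}
    (h : P.IsCorrectUpTo k t) {a : PDAAction Q T Γ} (ha : a ∈ P.actions) {m : ℕ} {s : Q}
    {w : List T} (hp : P.Pops m a.source [a.pop] w s) (hm : P.rank m < k + 1) :
    updateTable t a (a.source, a.pop) = s := by
  rw [updateTable, Function.update_self]
  obtain ⟨a', ha', hs, hX, l, u, rfl, rfl, hp'⟩ := hp.exists_action
  obtain rfl := hP _ ha' _ ha hs hX
  refine evalTable_eq hp' fun i hi q X w s hq => h i q X w s hq ?_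
  have := rank_lt_rank hP (show i < l + 1 by omega) hq
  omega

theorem IsCorrectUpTo.updateTable (hP : P.AtMostOneAction) {k : ℕ} {t : Q × Γ → Q}
    (h : P.IsCorrectUpTo k t) {a : PDAAction Q T Γ} (ha : a ∈ P.actions) :
    P.IsCorrectUpTo k (updateTable t a) := by
  intro m q X w s hp hm
  by_cases he : (q, X) = (a.source, a.pop)
  · rw [he]
    rw [Prod.mk.injEq] at he
    obtain ⟨rfl, rfl⟩ := he
    exact h.updateTable_self hP ha hp (by omega)
  · rw [PDA.updateTable, Function.update_of_ne he]
    exact h m q X w s hp hm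

theorem IsCorrect.updateTable (hP : P.AtMostOneAction) {t : Q × Γ → Q}
    (h : P.IsCorrect t) {a : PDAAction Q T Γ} (ha : a ∈ P.actions) :
    P.IsCorrect (updateTable t a) :=
  ((h.upTo _).updateTable hP ha).isCorrect hP

/-- During a round, an entry of rank at most `k` is correct as soon as an action for it has been
processed, and it remains correct from then on. -/
theorem IsCorrectUpTo.foldl_updateTable (hP : P.AtMostOneAction) {k : ℕ}
    (l : List (PDAAction Q T Γ)) : ∀ {t : Q × Γ → Q}, P.IsCorrectUpTo k t →
      (∀ a ∈ l, a ∈ P.actions) → ∀ m q X w s, P.Pops m q [X] w s → P.rank m < k + 1 →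
      ((∃ a ∈ l, a.source = q ∧ a.pop = X) ∨ t (q, X) = s) → tableRound l t (q, X) = s := by
  induction l with
  | nil => simp [tableRound]
  | cons a l ih =>
    intro t ht hl m q X w s hp hm hq
    have ha : a ∈ P.actions := hl a List.mem_cons_self
    refine ih (ht.updateTable hP ha) (fun b hb => hl b (List.mem_cons_of_mem a hb)) m q X w s hp hm
      ?_
    by_cases he : (q, X) = (a.source, a.pop)
    · rw [Prod.mk.injEq] at he
      obtain ⟨rfl, rfl⟩ := he
      exact Or.inr (ht.updateTable_self hP ha hp hm)
    · rcases hq with ⟨b, hb, rfl, rfl⟩ | hq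
      · rcases List.mem_cons.1 hb with rfl | hb
        · exact absurd rfl he
        · exact Or.inl ⟨b, hb, rfl, rfl⟩
      · exact Or.inr (by rw [PDA.updateTable, Function.update_of_ne he, hq])

theorem IsCorrectUpTo.tableRound (hP : P.AtMostOneAction) {k : ℕ} {t : Q × Γ → Q}
    (h : P.IsCorrectUpTo k t) {l : List (PDAAction Q T Γ)} (hl : ∀ a, a ∈ l ↔ a ∈ P.actions) :
    P.IsCorrectUpTo (k + 1) (tableRound l t) := by
  intro m q X w s hp hm
  obtain ⟨a, ha, hq, hX, -⟩ := hp.exists_action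
  exact h.foldl_updateTable hP l (fun a => (hl a).1) m q X w s hp hm
    (Or.inl ⟨a, (hl a).2 ha, hq, hX⟩)

/-- The ranks are less than the number of pairs of a state and a stack symbol, and so this number
of rounds suffices. -/
theorem isCorrect_iterate_tableRound (hP : P.AtMostOneAction) {l : List (PDAAction Q T Γ)}
    (hl : ∀ a, a ∈ l ↔ a ∈ P.actions) (t : Q × Γ → Q) :
    P.IsCorrect ((PDA.tableRound l)^[Fintype.card Q * Fintype.card Γ] t) := by
  have H : ∀ k, P.IsCorrectUpTo k ((PDA.tableRound l)^[k] t) := by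
    intro k
    induction k with
    | zero => exact fun m q X w s _ hm => absurd hm (Nat.not_lt_zero _)
    | succ k ih =>
      rw [Function.iterate_succ_apply']
      exact ih.tableRound hP hl
  exact (H _).isCorrect hP

end Rank

/-! ### The grammar -/

section Grammar

variable {V : Type}

/-- The word of variables for popping `β`, starting from the state `q`: the variable `code (r, X)`
stands for popping `X`, starting from the state `r`, and the table `t` tells the intermediate
states. -/
def popSymbols (code : Q × Γ → V) (t : Q × Γ → Q) (q : Q) : List Γ → List (Symbol T V)
  | [] => []
  | X :: β => .nonterminal (code (q, X)) :: popSymbols code t (t (q, X)) β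

/-- The rule for an action: to pop `a.pop`, read `a.read` and pop `a.push`. -/
def popRule (code : Q × Γ → V) (t : Q × Γ → Q) (a : PDAAction Q T Γ) : ContextFreeRule T V where
  input := code (a.source, a.pop)
  output := a.read.toList.map .terminal ++ popSymbols code t a.target a.push

/-- The rules for a list of actions, where the table is updated after each rule. -/
def popRules [DecidableEq Q] [DecidableEq Γ] (code : Q × Γ → V) :
    (Q × Γ → Q) → List (PDAAction Q T Γ) → List (ContextFreeRule T V)
  | _, [] => []
  | t, a :: l => popRule code t a :: popRules code (updateTable t a) l

/-- The language of a word of terminals and variables, if the languages of the variables are given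
by `L`. -/
def wordLanguage (L : V → Language T) (l : List (Symbol T V)) : Language T :=
  (l.map fun x => match x with
    | .terminal c => ({[c]} : Language T)
    | .nonterminal A => L A).prod

theorem wordLanguage_append (L : V → Language T) (l l' : List (Symbol T V)) :
    wordLanguage L (l ++ l') = wordLanguage L l * wordLanguage L l' := by
  simp [wordLanguage]

theorem wordLanguage_cons (L : V → Language T) (A : V) (l : List (Symbol T V)) :
    wordLanguage L (.nonterminal A :: l) = L A * wordLanguage L l := by
  simp [wordLanguage]

theorem wordLanguage_singleton (L : V → Language T) (A : V) :
    wordLanguage L [.nonterminal A] = L A := by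
  simp [wordLanguage]

theorem wordLanguage_terminal (L : V → Language T) (w : List T) :
    wordLanguage L (w.map .terminal) = {w} := by
  induction w with
  | nil => rfl
  | cons c w ih =>
    rw [wordLanguage] at ih ⊢
    simp only [List.map_cons, List.prod_cons, ih]
    ext v
    constructor
    · rintro ⟨_, rfl, _, rfl, rfl⟩
      rfl
    · rintro rfl
      exact ⟨[c], rfl, w, rfl, rfl⟩

/-- Languages that satisfy the rules as inclusions contain what the variables generate. -/
theorem wordLanguage_le_of_derives {g : ContextFreeGrammar T} {L : g.NT → Language T}
    (hL : ∀ ρ ∈ g.rules, wordLanguage L ρ.output ≤ L ρ.input) {u v : List (Symbol T g.NT)}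
    (h : g.Derives u v) : wordLanguage L v ≤ wordLanguage L u := by
  induction h with
  | refl => exact le_rfl
  | tail _ hp ih =>
    refine le_trans ?_ ih
    obtain ⟨ρ, hρ, hr⟩ := hp
    obtain ⟨x, y, rfl, rfl⟩ := hr.exists_parts
    simp only [wordLanguage_append]
    rw [wordLanguage_singleton]
    exact mul_le_mul' (mul_le_mul' le_rfl (hL ρ hρ)) le_rfl

/-- Completeness of the rules. The tables may differ from rule to rule, since only their correct
entries matter here. -/
theorem Pops.derives {g : ContextFreeGrammar T} {code : Q × Γ → g.NT}
    (hg : ∀ a ∈ P.actions, ∃ t, P.IsCorrect t ∧ popRule code t a ∈ g.rules)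
    {m : ℕ} {q s : Q} {β : List Γ} {w : List T} (h : P.Pops m q β w s) :
    ∀ t, P.IsCorrect t → g.Derives (popSymbols code t q β) (w.map .terminal) := by
  induction h with
  | nil q => exact fun t _ => .refl _
  | @cons m m' a β u v r s ha h₁ h₂ ih₁ ih₂ =>
    intro t ht
    obtain ⟨t', ht', hρ⟩ := hg a ha
    rw [popSymbols, ht _ _ _ _ _ (.of_action ha h₁), List.map_append, List.map_append]
    have d₁ : g.Produces [.nonterminal (code (a.source, a.pop))]
        (a.read.toList.map .terminal ++ popSymbols code t' a.target a.push) :=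
      ⟨_, hρ, ContextFreeRule.Rewrites.input_output⟩
    have d₂ := d₁.single.trans ((ih₁ t' ht').append_left (a.read.toList.map .terminal))
    exact (d₂.append_right (popSymbols code t r β)).trans ((ih₂ t ht).append_left _)

/-- The language of the variable for popping `X`, starting from the state `q`: the words that are
consumed in doing so. -/
def popLanguage (P : PDA Q T Γ) (code : Q × Γ → V) (A : V) : Language T :=
  {w | ∃ m q X s, A = code (q, X) ∧ P.Pops m q [X] w s}

/-- Soundness of the rules: if each variable `(q, X)` stands for words consumed while popping `X`,
then a correct table links these computations to one that pops the whole word `β`. -/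
theorem exists_pops_of_mem_popSymbols {code : Q × Γ → V} (hc : Function.Injective code)
    {t : Q × Γ → Q} (ht : P.IsCorrect t) (β : List Γ) : ∀ (q : Q) (w : List T),
    w ∈ wordLanguage (P.popLanguage code) (popSymbols code t q β) → ∃ m s, P.Pops m q β w s := by
  induction β with
  | nil =>
    intro q w hw
    obtain rfl : w = [] := by simpa [popSymbols, wordLanguage] using hw
    exact ⟨0, q, .nil q⟩
  | cons X β ih =>
    intro q w hw
    rw [popSymbols, wordLanguage_cons] at hw
    obtain ⟨u, ⟨m, q', X', s, he, h⟩, v, hv, rfl⟩ := hw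
    obtain ⟨rfl, rfl⟩ := Prod.mk.inj (hc he)
    rw [ht _ _ _ _ _ h] at hv
    obtain ⟨m', s', h'⟩ := ih s v hv
    obtain ⟨k, hk⟩ := h.append h'
    exact ⟨k, s', hk⟩

/-- A grammar whose rules are the rules of the actions, each of them with respect to some correct
table, generates the language of the automaton. Wrong entries of the tables do no harm: the
variables they lead to occur only next to variables that generate nothing. -/
theorem language_eq_of_rules {g : ContextFreeGrammar T} {code : Q × Γ → g.NT}
    (hc : Function.Injective code)
    (hi : g.initial = code (P.initState, P.initSymbol))
    (hg : ∀ a ∈ P.actions, ∃ t, P.IsCorrect t ∧ popRule code t a ∈ g.rules)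
    (hg' : ∀ ρ ∈ g.rules, ∃ a ∈ P.actions, ∃ t, P.IsCorrect t ∧ ρ = popRule code t a)
    (ht : ∃ t, P.IsCorrect t) : g.language = P.language := by
  ext w
  rw [mem_language_iff_pops, ContextFreeGrammar.mem_language_iff, hi]
  constructor
  · intro hd
    have hw := wordLanguage_le_of_derives (L := P.popLanguage code) ?_ hd
    · rw [wordLanguage_terminal, wordLanguage_singleton] at hw
      obtain ⟨m, q, X, s, he, h⟩ := hw (Set.mem_singleton w)
      obtain ⟨rfl, rfl⟩ := Prod.mk.inj (hc he)
      exact ⟨m, s, h⟩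
    · intro ρ hρ v hv
      obtain ⟨a, ha, t, ht, rfl⟩ := hg' ρ hρ
      rw [popRule, wordLanguage_append, wordLanguage_terminal] at hv
      obtain ⟨x, rfl, y, hy, rfl⟩ := hv
      obtain ⟨m, s, h⟩ := exists_pops_of_mem_popSymbols hc ht _ _ _ hy
      exact ⟨_, _, _, s, rfl, .of_action ha h⟩
  · rintro ⟨m, s, h⟩
    obtain ⟨t, ht⟩ := ht
    exact h.derives hg t ht

theorem exists_mem_popRules [Fintype Q] [Fintype Γ] [DecidableEq Q] [DecidableEq Γ]
    (hP : P.AtMostOneAction) (code : Q × Γ → V)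
    (l : List (PDAAction Q T Γ)) (hl : ∀ a ∈ l, a ∈ P.actions) {t : Q × Γ → Q}
    (ht : P.IsCorrect t) : ∀ a ∈ l, ∃ t', P.IsCorrect t' ∧ popRule code t' a ∈ popRules code t l := by
  induction l generalizing t with
  | nil => simp
  | cons b l ih =>
    intro a ha
    rcases List.mem_cons.1 ha with rfl | ha
    · exact ⟨t, ht, List.mem_cons_self⟩
    · obtain ⟨t', h, h'⟩ := ih (fun c hc => hl c (List.mem_cons_of_mem b hc))
        (ht.updateTable hP (hl b List.mem_cons_self)) a ha
      exact ⟨t', h, List.mem_cons_of_mem _ h'⟩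

theorem exists_of_mem_popRules [Fintype Q] [Fintype Γ] [DecidableEq Q] [DecidableEq Γ]
    (hP : P.AtMostOneAction) (code : Q × Γ → V)
    (l : List (PDAAction Q T Γ)) (hl : ∀ a ∈ l, a ∈ P.actions) {t : Q × Γ → Q}
    (ht : P.IsCorrect t) :
    ∀ ρ ∈ popRules code t l, ∃ a ∈ P.actions, ∃ t', P.IsCorrect t' ∧ ρ = popRule code t' a := by
  induction l generalizing t with
  | nil => simp [popRules]
  | cons b l ih =>
    intro ρ hρ
    have hb := hl b List.mem_cons_self
    rcases List.mem_cons.1 hρ with rfl | hρ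
    · exact ⟨b, hb, t, ht, rfl⟩
    · exact ih (fun c hc => hl c (List.mem_cons_of_mem b hc)) (ht.updateTable hP hb) ρ hρ

end Grammar

end PDA

/-- The initial table of the iteration, which is arbitrary. -/
def UDPDA.initTable (P : UDPDA) : Fin P.numStates × Fin P.numSymbols → Fin P.numStates :=
  fun _ => ⟨0, P.initState.pos⟩

/-- The grammar for a unary deterministic pushdown automaton. The variable for popping `X`,
starting from the state `q`, is the number `X + P.numSymbols * q`. -/
def UDPDA.toUnaryCFG (P : UDPDA) : UnaryCFG where
  numVars := P.numStates * P.numSymbols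
  start := finProdFinEquiv (P.initState, P.initSymbol)
  rules := PDA.popRules finProdFinEquiv
    ((PDA.tableRound P.actions)^[P.numStates * P.numSymbols] P.initTable) P.actions

theorem UDPDA.toUnaryCFG_language (P : UDPDA) :
    P.toUnaryCFG.toCFG.language = P.toPDA.language := by
  have hP : P.toPDA.AtMostOneAction := PDA.IsDeterministic.atMostOneAction P.deterministic
  have hl : ∀ a, a ∈ P.actions ↔ a ∈ P.toPDA.actions := fun a => by simp [UDPDA.toPDA]
  have ht := PDA.isCorrect_iterate_tableRound hP hl P.initTable
  rw [Fintype.card_fin, Fintype.card_fin] at ht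
  refine PDA.language_eq_of_rules (g := P.toUnaryCFG.toCFG) (code := finProdFinEquiv)
    finProdFinEquiv.injective rfl ?_ ?_ ⟨_, ht⟩
  · intro a ha
    obtain ⟨t', h, h'⟩ := PDA.exists_mem_popRules hP finProdFinEquiv P.actions
      (fun a => (hl a).1) ht a ((hl a).2 ha)
    exact ⟨t', h, (List.mem_toFinset (α := ContextFreeRule Unit (Fin P.toUnaryCFG.numVars))).2 h'⟩
  · intro ρ hρ
    exact PDA.exists_of_mem_popRules hP finProdFinEquiv P.actions (fun a => (hl a).1) ht ρ
      ((List.mem_toFinset (α := ContextFreeRule Unit (Fin P.toUnaryCFG.numVars))).1 hρ)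

namespace UDPDAConverter

/-! ### The memory of the machine -/

instance : Inhabited Letter := ⟨.one⟩

instance : Fintype Letter := ⟨{.one, .comma, .semi}, fun a => by cases a <;> simp⟩

/-- The stacks of the machine: `io` holds the input (later on its rows that are still to be
processed) and in the end the output; `bak` the part of the input that is already processed; `out`
the rules and `hdr` the header of the output; `tab` and `tab₂` the two parts of the table of target
states. The remaining stacks hold numbers in unary. All stacks but `io` and `tab` are filled from
left to right, so that their contents have to be read backwards. -/
inductive Reg
  | io | bak | out | hdr | tab | tab₂ | p | p₂ | q | x | r | y | cnt
deriving DecidableEq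

instance : Fintype Reg :=
  ⟨{.io, .bak, .out, .hdr, .tab, .tab₂, .p, .p₂, .q, .x, .r, .y, .cnt},
    fun k => by cases k <;> decide⟩

/-- The contents of all stacks. Stacks that hold numbers are given by the numbers. -/
structure Mem where
  io : List Letter := []
  bak : List Letter := []
  out : List Letter := []
  hdr : List Letter := []
  tab : List Letter := []
  tab₂ : List Letter := []
  p : ℕ := 0
  p₂ : ℕ := 0
  q : ℕ := 0
  x : ℕ := 0
  r : ℕ := 0
  y : ℕ := 0
  cnt : ℕ := 0

/-- The contents of the stacks as a function. -/
def Mem.stk (m : Mem) : Reg → List Letter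
  | .io => m.io
  | .bak => m.bak
  | .out => m.out
  | .hdr => m.hdr
  | .tab => m.tab
  | .tab₂ => m.tab₂
  | .p => List.replicate m.p .one
  | .p₂ => List.replicate m.p₂ .one
  | .q => List.replicate m.q .one
  | .x => List.replicate m.x .one
  | .r => List.replicate m.r .one
  | .y => List.replicate m.y .one
  | .cnt => List.replicate m.cnt .one

/-- `Exec B c m m'`: the program `c` turns the memory `m` into `m'`, with at most `B` iterations in
each execution of a loop. -/
def Exec (B : ℕ) (c : StackProg Reg Letter) (m m' : Mem) : Prop :=
  c.Runs B m.stk m'.stk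

open StackProg

/-- Repeat `c` as long as the number at the top of the stack `k` is not exhausted. -/
def whileOne (k : Reg) (c : StackProg Reg Letter) : StackProg Reg Letter :=
  loop k (fun o => o == some .one) c

/-- Move the letters of one stack to another one, one by one. -/
def pour (k k' : Reg) : StackProg Reg Letter :=
  loop k Option.isSome (move k k')

/-- Empty a stack. -/
def clear (k : Reg) : StackProg Reg Letter :=
  loop k Option.isSome (pop k)

/-- A finite sequence of numbers as a word. -/
def nums (l : List ℕ) : List Letter :=
  l.flatMap fun k => List.replicate k .one ++ [.comma]

theorem nums_cons (k : ℕ) (l : List ℕ) :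
    nums (k :: l) = List.replicate k .one ++ .comma :: nums l := by
  simp [nums]

theorem nums_append (l l' : List ℕ) : nums (l ++ l') = nums l ++ nums l' := by
  simp [nums]

theorem encodeTable_cons (l : List ℕ) (t : List (List ℕ)) :
    encodeTable (l :: t) = nums l ++ .semi :: encodeTable t := by
  simp [encodeTable, nums]

theorem replicate_append_cons_self {α : Type} (n : ℕ) (a : α) (l : List α) :
    List.replicate n a ++ a :: l = a :: (List.replicate n a ++ l) := by
  rw [← List.cons_append, ← List.replicate_succ, List.replicate_succ', List.append_assoc]
  rfl

section Exec

variable {B : ℕ} {c d : StackProg Reg Letter} {m m' m'' : Mem} {k k' : Reg}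

theorem Exec.seq (h : Exec B c m m') (h' : Exec B d m' m'') : Exec B (c ;; d) m m'' :=
  ⟨_, h, h'⟩

theorem exec_push {a : Letter}
    (h : m'.stk = Function.update m.stk k (a :: m.stk k) := by funext j; cases j <;> rfl) :
    Exec B (push k a) m m' :=
  h

theorem exec_pop
    (h : m'.stk = Function.update m.stk k (m.stk k).tail := by funext j; cases j <;> rfl) :
    Exec B (pop k) m m' :=
  h

theorem exec_move {a : Letter} {l : List Letter} (hk : m.stk k = a :: l := by rfl)
    (h : m'.stk = Function.update (Function.update m.stk k l) k'
      (a :: Function.update m.stk k l k') := by funext j; cases j <;> rfl) :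
    Exec B (move k k') m m' :=
  ⟨a, l, hk, h⟩

/-- Execution of a loop that counts down the number at the top of the stack `k`. In `Φ j v` there
were `j` iterations so far, and `v` are left. -/
theorem exec_whileOne (l : List Letter) (hl : l.head? ≠ some .one) (Φ : ℕ → ℕ → Mem) {n : ℕ}
    (hn : n ≤ B) (hk : ∀ j v, (Φ j v).stk k = List.replicate v .one ++ l)
    (hc : ∀ j v, j + (v + 1) = n → Exec B c (Φ j (v + 1)) (Φ (j + 1) v)) :
    Exec B (whileOne k c) (Φ 0 n) (Φ n 0) := by
  have H : ∀ v j, j + v = n →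
      LoopRuns (c.Runs B) (fun S => (fun o => o == some Letter.one) (S k).head? = true) v
        (Φ j v).stk (Φ n 0).stk := by
    intro v
    induction v with
    | zero =>
      rintro j rfl
      exact ⟨by simpa [hk] using hl, rfl⟩
    | succ v ih =>
      intro j hj
      exact ⟨by simp [hk, List.replicate_succ], _, hc j v hj, ih (j + 1) (by omega)⟩
  exact ⟨n, hn, H n 0 (Nat.zero_add n)⟩

theorem runs_pour (hkk : k ≠ k') (n : ℕ) : ∀ (S : Reg → List Letter), (S k).length = n →
    LoopRuns ((StackProg.move k k').Runs B) (fun S => Option.isSome (S k).head? = true) n S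
      (Function.update (Function.update S k []) k' ((S k).reverse ++ S k')) := by
  induction n with
  | zero =>
    intro S hS
    rw [List.length_eq_zero_iff] at hS
    refine ⟨by simp [hS], ?_⟩
    rw [← hS, Function.update_eq_self, hS, List.reverse_nil, List.nil_append,
      Function.update_eq_self]
  | succ n ih =>
    intro S hS
    obtain ⟨a, l, h⟩ := List.exists_cons_of_length_eq_add_one hS
    refine ⟨by simp [h], _, ⟨a, l, h, rfl⟩, ?_⟩
    have := ih (Function.update (Function.update S k l) k' (a :: Function.update S k l k'))
      (by simpa [hkk, h] using hS)
    convert this using 1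
    funext j
    by_cases hj' : j = k'
    · subst hj'
      simp [hkk, hkk.symm, h]
    · by_cases hj : j = k
      · subst hj
        simp [hkk]
      · simp [hj, hj']

theorem exec_pour (hkk : k ≠ k' := by decide) (hB : (m.stk k).length ≤ B)
    (h : m'.stk = Function.update (Function.update m.stk k []) k' ((m.stk k).reverse ++ m.stk k') :=
      by funext j; cases j <;> rfl) :
    Exec B (pour k k') m m' :=
  ⟨_, hB, h ▸ runs_pour hkk _ _ rfl⟩

theorem runs_clear (n : ℕ) : ∀ (S : Reg → List Letter), (S k).length = n →
    LoopRuns ((StackProg.pop k : StackProg Reg Letter).Runs B)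
      (fun S => Option.isSome (S k).head? = true) n S (Function.update S k []) := by
  induction n with
  | zero =>
    intro S hS
    rw [List.length_eq_zero_iff] at hS
    exact ⟨by simp [hS], by rw [← hS, Function.update_eq_self]⟩
  | succ n ih =>
    intro S hS
    obtain ⟨a, l, h⟩ := List.exists_cons_of_length_eq_add_one hS
    refine ⟨by simp [h], _, rfl, ?_⟩
    have := ih (Function.update S k (S k).tail) (by simp [h] at hS ⊢; exact hS)
    rwa [Function.update_idem] at this

theorem exec_clear (hB : (m.stk k).length ≤ B)
    (h : m'.stk = Function.update m.stk k [] := by funext j; cases j <;> rfl) :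
    Exec B (clear k) m m' :=
  ⟨_, hB, h ▸ runs_clear _ _ rfl⟩

end Exec

/-! ### Walking through the table -/

/-- Repeat `c` for `y + p * r` times, where `y`, `p` and `r` are the numbers on the stacks `ky`,
`p` and `kr`. The first and the last of them are consumed. -/
def eachCode (kr ky : Reg) (c : StackProg Reg Letter) : StackProg Reg Letter :=
  whileOne kr (pop kr ;; whileOne .p (pop .p ;; push .p₂ .one ;; c) ;;
    whileOne .p₂ (pop .p₂ ;; push .p .one)) ;;
  whileOne ky (pop ky ;; c)

/-- In `Φ j a b v w` there were `j` executions of `c`, and `a`, `b`, `v` and `w` are the numbers on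
the stacks `p`, `p₂`, `kr` and `ky`. -/
theorem exec_eachCode {B : ℕ} {kr ky : Reg} {c : StackProg Reg Letter}
    (Φ : ℕ → ℕ → ℕ → ℕ → ℕ → Mem) {p r y : ℕ} (hp : p ≤ B) (hr : r ≤ B) (hy : y ≤ B)
    (sp : ∀ j a b v w, (Φ j a b v w).stk .p = List.replicate a .one)
    (sp₂ : ∀ j a b v w, (Φ j a b v w).stk .p₂ = List.replicate b .one)
    (sr : ∀ j a b v w, (Φ j a b v w).stk kr = List.replicate v .one)
    (sy : ∀ j a b v w, (Φ j a b v w).stk ky = List.replicate w .one)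
    (hpop : ∀ j a b v w, Exec B (pop .p) (Φ j (a + 1) b v w) (Φ j a b v w))
    (hpop₂ : ∀ j a b v w, Exec B (pop .p₂) (Φ j a (b + 1) v w) (Φ j a b v w))
    (hpush : ∀ j a b v w, Exec B (push .p .one) (Φ j a b v w) (Φ j (a + 1) b v w))
    (hpush₂ : ∀ j a b v w, Exec B (push .p₂ .one) (Φ j a b v w) (Φ j a (b + 1) v w))
    (hpopr : ∀ j a b v w, Exec B (pop kr) (Φ j a b (v + 1) w) (Φ j a b v w))
    (hpopy : ∀ j a b v w, Exec B (pop ky) (Φ j a b v (w + 1)) (Φ j a b v w))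
    (hc : ∀ j < y + p * r, ∀ a b v w, Exec B c (Φ j a b v w) (Φ (j + 1) a b v w)) :
    Exec B (eachCode kr ky c) (Φ 0 p 0 r y) (Φ (y + p * r) p 0 0 0) := by
  have h₁ : Exec B (whileOne kr (pop kr ;; whileOne .p (pop .p ;; push .p₂ .one ;; c) ;;
      whileOne .p₂ (pop .p₂ ;; push .p .one))) (Φ (p * 0) p 0 r y) (Φ (p * r) p 0 0 y) := by
    refine exec_whileOne [] (by simp) (fun j v => Φ (p * j) p 0 v y) hr (by simp [sr]) ?_
    intro j v hv
    have hj : p * (j + 1) ≤ p * r := Nat.mul_le_mul_left p (by omega)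
    rw [Nat.mul_add, Nat.mul_one] at hj
    refine (hpopr _ _ _ _ _).seq (.seq (m' := Φ (p * j + p) 0 p v y) ?_ ?_)
    · exact exec_whileOne [] (by simp) (fun i a => Φ (p * j + i) a i v y) hp (by simp [sp])
        fun i a hi => (hpop _ _ _ _ _).seq ((hpush₂ _ _ _ _ _).seq (hc _ (by omega) _ _ _ _))
    · exact exec_whileOne [] (by simp) (fun i b => Φ (p * j + p) i b v y) hp (by simp [sp₂])
        fun i b _ => (hpop₂ _ _ _ _ _).seq (hpush _ _ _ _ _)
  have h₂ : Exec B (whileOne ky (pop ky ;; c)) (Φ (p * r + 0) p 0 0 y) (Φ (p * r + y) p 0 0 0) :=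
    exec_whileOne [] (by simp) (fun j w => Φ (p * r + j) p 0 0 w) hy (by simp [sy])
      fun j w hj => (hpopy _ _ _ _ _).seq (hc _ (by omega) _ _ _ _)
  rw [Nat.add_comm y]
  exact h₁.seq h₂

theorem exec_eachCode_r_y {B : ℕ} {c : StackProg Reg Letter} (μ : ℕ → Mem) {p r y : ℕ}
    (hp : p ≤ B) (hr : r ≤ B) (hy : y ≤ B)
    (hc : ∀ j < y + p * r, ∀ a b v w, Exec B c { μ j with p := a, p₂ := b, r := v, y := w }
      { μ (j + 1) with p := a, p₂ := b, r := v, y := w }) :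
    Exec B (eachCode .r .y c) { μ 0 with p := p, p₂ := 0, r := r, y := y }
      { μ (y + p * r) with p := p, p₂ := 0, r := 0, y := 0 } :=
  exec_eachCode (fun j a b v w => { μ j with p := a, p₂ := b, r := v, y := w }) hp hr hy
    (fun _ _ _ _ _ => rfl) (fun _ _ _ _ _ => rfl) (fun _ _ _ _ _ => rfl) (fun _ _ _ _ _ => rfl)
    (fun _ _ _ _ _ => exec_pop) (fun _ _ _ _ _ => exec_pop) (fun _ _ _ _ _ => exec_push)
    (fun _ _ _ _ _ => exec_push) (fun _ _ _ _ _ => exec_pop) (fun _ _ _ _ _ => exec_pop) hc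

theorem exec_eachCode_q_x {B : ℕ} {c : StackProg Reg Letter} (μ : ℕ → Mem) {p q x : ℕ}
    (hp : p ≤ B) (hq : q ≤ B) (hx : x ≤ B)
    (hc : ∀ j < x + p * q, ∀ a b v w, Exec B c { μ j with p := a, p₂ := b, q := v, x := w }
      { μ (j + 1) with p := a, p₂ := b, q := v, x := w }) :
    Exec B (eachCode .q .x c) { μ 0 with p := p, p₂ := 0, q := q, x := x }
      { μ (x + p * q) with p := p, p₂ := 0, q := 0, x := 0 } :=
  exec_eachCode (fun j a b v w => { μ j with p := a, p₂ := b, q := v, x := w }) hp hq hx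
    (fun _ _ _ _ _ => rfl) (fun _ _ _ _ _ => rfl) (fun _ _ _ _ _ => rfl) (fun _ _ _ _ _ => rfl)
    (fun _ _ _ _ _ => exec_pop) (fun _ _ _ _ _ => exec_pop) (fun _ _ _ _ _ => exec_push)
    (fun _ _ _ _ _ => exec_push) (fun _ _ _ _ _ => exec_pop) (fun _ _ _ _ _ => exec_pop) hc

/-- Pass over one entry of the table. -/
def skipEntry : StackProg Reg Letter :=
  whileOne .tab (move .tab .tab₂) ;; move .tab .tab₂

/-- The memory `m` with the table `L`, of which the first `j` entries are passed over. -/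
def Mem.atEntry (m : Mem) (L : List ℕ) (j : ℕ) : Mem :=
  { m with tab := nums (L.drop j), tab₂ := (nums (L.take j)).reverse }

theorem exec_skipEntry {B j : ℕ} {L : List ℕ} (hj : j < L.length) (hB : ∀ e ∈ L, e ≤ B) (m : Mem) :
    Exec B skipEntry (m.atEntry L j) (m.atEntry L (j + 1)) := by
  have h := exec_whileOne (B := B) (k := .tab) (c := StackProg.move .tab .tab₂)
    (.comma :: nums (L.drop (j + 1))) (by simp)
    (fun i v => { m with
      tab := List.replicate v .one ++ .comma :: nums (L.drop (j + 1)),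
      tab₂ := List.replicate i .one ++ (nums (L.take j)).reverse })
    (n := L[j]) (hB _ (List.getElem_mem hj)) (fun _ _ => rfl) (fun _ _ _ => exec_move)
  rw [Mem.atEntry, List.drop_eq_getElem_cons hj, nums_cons, Mem.atEntry,
    List.take_succ_eq_append_getElem hj, nums_append, nums_cons]
  refine h.seq (exec_move (by rfl) ?_)
  funext j
  cases j <;> simp [Mem.stk, nums]

/-! ### The table of target states as a list of numbers -/

section Table

variable {n p : ℕ}

/-- The entries of a table in the order of the numbers `X + p * q` of the pairs `(q, X)`. -/
def tableList (t : Fin n × Fin p → Fin n) : List ℕ :=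
  List.ofFn fun i : Fin (n * p) => (t (finProdFinEquiv.symm i) : ℕ)

theorem length_tableList (t : Fin n × Fin p → Fin n) : (tableList t).length = n * p :=
  List.length_ofFn

theorem code_lt (q : Fin n) (X : Fin p) : (X + p * q : ℕ) < n * p :=
  (finProdFinEquiv (q, X)).isLt

theorem code_lt_length (t : Fin n × Fin p → Fin n) (q : Fin n) (X : Fin p) :
    (X + p * q : ℕ) < (tableList t).length :=
  (code_lt q X).trans_eq (length_tableList t).symm

theorem tableList_getElem (t : Fin n × Fin p → Fin n) (q : Fin n) (X : Fin p) :
    (tableList t)[(X + p * q : ℕ)]'(code_lt_length t q X) = t (q, X) := by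
  have h : finProdFinEquiv.symm ⟨(X + p * q : ℕ), code_lt q X⟩ = (q, X) := by
    rw [Equiv.symm_apply_eq]
    rfl
  simp only [tableList, List.getElem_ofFn, h]

theorem tableList_update (t : Fin n × Fin p → Fin n) (q : Fin n) (X : Fin p) (s : Fin n) :
    tableList (Function.update t (q, X) s) = (tableList t).set (X + p * q) s := by
  refine List.ext_getElem (by simp [length_tableList]) fun i h₁ h₂ => ?_
  rw [length_tableList] at h₁
  simp only [tableList, List.getElem_ofFn, List.getElem_set]
  split_ifs with h
  · have : finProdFinEquiv.symm ⟨i, h₁⟩ = (q, X) := by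
      rw [Equiv.symm_apply_eq]
      exact Fin.ext h.symm
    rw [this, Function.update_self]
  · rw [Function.update_of_ne]
    intro h'
    rw [Equiv.symm_apply_eq] at h'
    exact h (congrArg Fin.val h').symm

theorem lt_of_mem_tableList {t : Fin n × Fin p → Fin n} {e : ℕ} (he : e ∈ tableList t) : e < n := by
  obtain ⟨i, rfl⟩ := List.mem_ofFn.1 he
  exact Fin.isLt _

theorem length_nums (l : List ℕ) : (nums l).length = (l.map (· + 1)).sum := by
  induction l with
  | nil => rfl
  | cons k l ih => simp [nums_cons, ih]; omega

theorem length_nums_le {l : List ℕ} {n : ℕ} (h : ∀ k ∈ l, k < n) :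
    (nums l).length ≤ l.length * n := by
  rw [length_nums]
  refine (List.sum_le_card_nsmul _ n ?_).trans_eq (by simp)
  simpa using h

theorem length_nums_tableList (t : Fin n × Fin p → Fin n) :
    (nums (tableList t)).length ≤ n * p * n := by
  rw [← length_tableList t]
  exact length_nums_le fun k => lt_of_mem_tableList

theorem nums_eq_split (L : List ℕ) {j : ℕ} (hj : j < L.length) :
    nums L = nums (L.take j) ++
      (List.replicate L[j] .one ++ .comma :: nums (L.drop (j + 1))) := by
  rw [← nums_cons, ← List.drop_eq_getElem_cons hj, ← nums_append, List.take_append_drop]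

end Table

/-! ### Processing one action -/

/-- Move a number from the input to `bak`, and do `c` as many times as the number says. -/
def readNum (c : StackProg Reg Letter) : StackProg Reg Letter :=
  whileOne .io (move .io .bak ;; c) ;; move .io .bak

theorem exec_readNum {B : ℕ} {c : StackProg Reg Letter} (μ : ℕ → Mem) {v : ℕ} (hv : v ≤ B)
    (l b : List Letter)
    (hc : ∀ j < v, ∀ l b, Exec B c { μ j with io := l, bak := b }
      { μ (j + 1) with io := l, bak := b }) :
    Exec B (readNum c) { μ 0 with io := List.replicate v .one ++ .comma :: l, bak := b }
      { μ v with io := l, bak := .comma :: (List.replicate v .one ++ b) } :=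
  (exec_whileOne (.comma :: l) (by simp)
    (fun j i => { μ j with
      io := List.replicate i .one ++ .comma :: l,
      bak := List.replicate j .one ++ b }) hv (fun _ _ => rfl)
    fun j i hi => (exec_move (m' := { μ j with
      io := List.replicate i .one ++ .comma :: l,
      bak := List.replicate (j + 1) .one ++ b })).seq (hc j (by omega) _ _)).seq exec_move

/-- For the state `r` on the stack `r` and the next symbol `Y` of the input, write the variable for
popping `Y` from `r`, and replace `r` by the entry of the table for `(r, Y)`. -/
def popItem : StackProg Reg Letter :=
  readNum (push .y .one) ;; push .out .one ;; eachCode .r .y (push .out .one ;; skipEntry) ;;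
  push .out .comma ;; whileOne .tab (move .tab .tab₂ ;; push .r .one) ;; pour .tab₂ .tab

/-- Replace the entry of the table for the state and the symbol on the stacks `q` and `x` by the state
on the stack `r`. -/
def writeEntry : StackProg Reg Letter :=
  eachCode .q .x skipEntry ;; whileOne .tab (pop .tab) ;;
  whileOne .r (pop .r ;; push .tab .one) ;; pour .tab₂ .tab

/-- Process the action at the top of the input: write its rule and update the table. -/
def processRow : StackProg Reg Letter :=
  readNum (push .r .one ;; push .q .one) ;; readNum (push .y .one ;; push .x .one) ;;
  eachCode .r .y (push .out .one ;; skipEntry) ;; push .out .comma ;; pour .tab₂ .tab ;;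
  readNum (push .out .comma) ;; readNum (push .r .one) ;;
  loop .io (fun o => o != some .semi) popItem ;; move .io .bak ;; push .out .semi ;;
  writeEntry

section Row

variable {n p B : ℕ}

/-- The memory while an action is processed. -/
def rowMem (h : List Letter) (c : ℕ) (t : Fin n × Fin p → Fin n) (l b o : List Letter)
    (q x r : ℕ) : Mem where
  io := l
  bak := b
  out := o
  hdr := h
  tab := nums (tableList t)
  p := p
  q := q
  x := x
  r := r
  cnt := c

/-- Writing the number of the variable `(r, Y)` leads to its entry in the table. -/
theorem exec_writeCode (hn : n ≤ B) (hp : p ≤ B) (m : Mem) (t : Fin n × Fin p → Fin n)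
    (o : List Letter) (r : Fin n) (Y : Fin p) :
    Exec B (eachCode .r .y (push .out .one ;; skipEntry))
      { m with out := o, tab := nums (tableList t), tab₂ := [], p := p, p₂ := 0, r := r, y := Y }
      { m.atEntry (tableList t) (Y + p * r) with
        out := List.replicate (Y + p * r) .one ++ o, p := p, p₂ := 0, r := 0, y := 0 } :=
  exec_eachCode_r_y
    (fun j => { m.atEntry (tableList t) j with out := List.replicate j .one ++ o })
    hp (r.isLt.le.trans hn) (Y.isLt.le.trans hp)
    fun j hj a b v w => (exec_push (m' := { m.atEntry (tableList t) j with
        out := List.replicate (j + 1) .one ++ o, p := a, p₂ := b, r := v, y := w })).seq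
      (exec_skipEntry (hj.trans (code_lt_length t r Y))
        (fun e he => (lt_of_mem_tableList he).le.trans hn)
        { m with out := List.replicate (j + 1) .one ++ o, p := a, p₂ := b, r := v, y := w })

theorem exec_restoreTable {L : List ℕ} {j : ℕ} (hL : (nums L).length ≤ B) (m : Mem) :
    Exec B (pour .tab₂ .tab) (m.atEntry L j) { m with tab := nums L, tab₂ := [] } := by
  have h : nums L = nums (L.take j) ++ nums (L.drop j) := by
    rw [← nums_append, List.take_append_drop]
  refine exec_pour (by decide) ?_ ?_
  · rw [h, List.length_append] at hL
    simp only [Mem.stk, Mem.atEntry, List.length_reverse]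
    omega
  · funext i
    cases i <;> simp [Mem.stk, Mem.atEntry, h]

theorem exec_popItem (hn : n ≤ B) (hp : p ≤ B) (hT : n * p * n ≤ B) (h : List Letter) (c : ℕ)
    (t : Fin n × Fin p → Fin n) (l b o : List Letter) (q x : ℕ) (r : Fin n) (Y : Fin p) :
    Exec B popItem (rowMem h c t (List.replicate Y .one ++ .comma :: l) b o q x r)
      (rowMem h c t l (.comma :: (List.replicate Y .one ++ b))
        (.comma :: (List.replicate (Y + p * r + 1) .one ++ o)) q x (t (r, Y))) := by
  have hL := nums_eq_split (tableList t) (code_lt_length t r Y)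
  have hlen := length_nums_tableList t
  rw [tableList_getElem] at hL
  have hd := List.drop_eq_getElem_cons (code_lt_length t r Y)
  rw [tableList_getElem] at hd
  refine (exec_readNum (fun j => { rowMem h c t l b o q x r with y := j })
    (Y.isLt.le.trans hp) l b fun _ _ _ _ => exec_push).seq ?_
  refine (exec_push (m' := { rowMem h c t l (.comma :: (List.replicate Y .one ++ b)) (.one :: o)
    q x r with y := Y })).seq ?_
  refine (exec_writeCode hn hp (rowMem h c t l (.comma :: (List.replicate Y .one ++ b)) []
    q x 0) t (.one :: o) r Y).seq ?_
  rw [replicate_append_cons_self]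
  set o' := Letter.comma :: (List.replicate (Y + p * r + 1 : ℕ) Letter.one ++ o)
  set b' := Letter.comma :: (List.replicate (Y : ℕ) Letter.one ++ b)
  refine (exec_push (m' := { (rowMem h c t l b' o' q x 0).atEntry (tableList t) (Y + p * r) with
    r := 0 })).seq ?_
  -- copy the entry to the stack `r`
  have h₁ := exec_whileOne (B := B) (k := .tab) (c := move .tab .tab₂ ;; push .r .one)
    (.comma :: nums ((tableList t).drop (Y + p * r + 1))) (by simp)
    (fun i v => { rowMem h c t l b' o' q x i with
      tab := List.replicate v .one ++ .comma :: nums ((tableList t).drop (Y + p * r + 1))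
      tab₂ := List.replicate i .one ++ (nums ((tableList t).take (Y + p * r))).reverse })
    ((t (r, Y)).isLt.le.trans hn) (fun _ _ => rfl) fun i v _ =>
      (exec_move (m' := { rowMem h c t l b' o' q x i with
        tab := List.replicate v .one ++ .comma :: nums ((tableList t).drop (Y + p * r + 1))
        tab₂ := List.replicate (i + 1) .one ++
          (nums ((tableList t).take (Y + p * r))).reverse })).seq exec_push
  refine Exec.seq (m' := _) ?_ (exec_pour (m := { rowMem h c t l b' o' q x (t (r, Y)) with
      tab := .comma :: nums ((tableList t).drop (Y + p * r + 1))
      tab₂ := List.replicate (t (r, Y)) .one ++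
        (nums ((tableList t).take (Y + p * r))).reverse }) (by decide) ?_ ?_)
  · rw [Mem.atEntry, hd, nums_cons]
    exact h₁
  · refine le_trans ?_ (hlen.trans hT)
    rw [hL]
    simp [Mem.stk]
    omega
  · funext j
    cases j <;> simp [Mem.stk, rowMem, hL]

theorem exec_popItems (hn : n ≤ B) (hp : p ≤ B) (hT : n * p * n ≤ B) (h : List Letter) (c : ℕ)
    (t : Fin n × Fin p → Fin n) (l : List Letter) (q x : ℕ) (β : List (Fin p))
    (hβ : β.length ≤ B) (b o : List Letter) (r : Fin n) :
    Exec B (loop .io (fun o => o != some .semi) popItem)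
      (rowMem h c t (nums (β.map Fin.val) ++ .semi :: l) b o q x r)
      (rowMem h c t (.semi :: l) ((nums (β.map Fin.val)).reverse ++ b)
        ((nums ((PDA.popSymbols (T := Unit) finProdFinEquiv t r β).map symbolCode)).reverse ++ o)
        q x (PDA.evalTable t r β).val) := by
  refine ⟨β.length, hβ, ?_⟩
  clear hβ
  induction β generalizing b o r with
  | nil => exact ⟨by simp [Mem.stk, rowMem, nums], rfl⟩
  | cons Y β ih =>
    have h₁ := ih (.comma :: (List.replicate Y .one ++ b))
      (.comma :: (List.replicate (Y + p * r + 1) .one ++ o)) (t (r, Y))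
    have h₂ := exec_popItem hn hp hT h c t (nums (β.map Fin.val) ++ .semi :: l) b o q x r Y
    have e : symbolCode (Symbol.nonterminal (finProdFinEquiv (r, Y)) : Symbol Unit _) =
        Y + p * r + 1 := rfl
    simp only [List.map_cons, nums_cons, PDA.popSymbols, PDA.evalTable, e, List.reverse_append,
      List.reverse_cons, List.append_assoc, List.cons_append, List.nil_append,
      List.reverse_replicate]
    refine ⟨?_, _, h₂, h₁⟩
    cases hY : (Y : ℕ) <;> simp [Mem.stk, rowMem, List.replicate_succ]

/-- The row of the input for an action. -/
def actionRow (a : PDAAction (Fin n) Unit (Fin p)) : List ℕ :=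
  (a.source : ℕ) :: (a.pop : ℕ) :: a.read.toList.length :: (a.target : ℕ) :: a.push.map Fin.val

/-- The row of the output for a rule. -/
def ruleRow {v : ℕ} (ρ : ContextFreeRule Unit (Fin v)) : List ℕ :=
  (ρ.input : ℕ) :: ρ.output.map symbolCode

theorem exec_writeEntry (hn : n ≤ B) (hp : p ≤ B) (hT : n * p * n ≤ B) (h : List Letter) (c : ℕ)
    (t : Fin n × Fin p → Fin n) (l b o : List Letter) (s e : Fin n) (X : Fin p) :
    Exec B writeEntry (rowMem h c t l b o s X e)
      (rowMem h c (Function.update t (s, X) e) l b o 0 0 0) := by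
  have hX := code_lt_length t s X
  have hd := List.drop_eq_getElem_cons hX
  have he : (tableList t)[(X + p * s : ℕ)] ≤ B :=
    (lt_of_mem_tableList (List.getElem_mem hX)).le.trans hn
  refine (exec_eachCode_q_x (fun j => (rowMem h c t l b o s X e).atEntry (tableList t) j) hp
    (s.isLt.le.trans hn) (X.isLt.le.trans hp) fun j hj a b' v w =>
      exec_skipEntry (hj.trans hX) (fun e he => (lt_of_mem_tableList he).le.trans hn)
        { rowMem h c t l b o v w e with p := a, p₂ := b' }).seq ?_
  have h₁ := exec_whileOne (B := B) (k := .tab) (c := StackProg.pop .tab)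
    (.comma :: nums ((tableList t).drop (X + p * s + 1))) (by simp)
    (fun i v => { rowMem h c t l b o 0 0 e with
      tab := List.replicate v .one ++ .comma :: nums ((tableList t).drop (X + p * s + 1))
      tab₂ := (nums ((tableList t).take (X + p * s))).reverse })
    he (fun _ _ => rfl) fun _ _ _ => exec_pop
  have h₂ := exec_whileOne (B := B) (k := .r) (c := StackProg.pop .r ;; push .tab .one) [] (by simp)
    (fun i v => { rowMem h c t l b o 0 0 v with
      tab := List.replicate i .one ++ .comma :: nums ((tableList t).drop (X + p * s + 1))
      tab₂ := (nums ((tableList t).take (X + p * s))).reverse })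
    (e.isLt.le.trans hn) (fun _ _ => (List.append_nil _).symm) fun i v _ =>
      (exec_pop (m' := { rowMem h c t l b o 0 0 v with
        tab := List.replicate i .one ++ .comma :: nums ((tableList t).drop (X + p * s + 1))
        tab₂ := (nums ((tableList t).take (X + p * s))).reverse })).seq exec_push
  have hL := (length_nums_tableList t).trans hT
  rw [nums_eq_split _ hX, List.length_append] at hL
  refine Exec.seq (m' := _) ?_ (h₂.seq (exec_pour (by decide) ?_ ?_))
  · rw [Mem.atEntry, hd, nums_cons]
    exact h₁
  · simp only [Mem.stk, List.length_reverse]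
    omega
  · funext i
    cases i <;> simp [Mem.stk, rowMem, tableList_update, List.set_eq_take_append_cons_drop, hX,
      nums_append, nums_cons]

theorem exec_processRow (hn : n ≤ B) (hp : p ≤ B) (hT : n * p * n ≤ B) (h : List Letter) (c : ℕ)
    (t : Fin n × Fin p → Fin n) (l b o : List Letter) (a : PDAAction (Fin n) Unit (Fin p))
    (ha : a.push.length ≤ B) :
    Exec B processRow (rowMem h c t (nums (actionRow a) ++ .semi :: l) b o 0 0 0)
      (rowMem h c (PDA.updateTable t a) l ((nums (actionRow a) ++ [Letter.semi]).reverse ++ b)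
        ((nums (ruleRow (PDA.popRule finProdFinEquiv t a)) ++ [Letter.semi]).reverse ++ o) 0 0 0) := by
  obtain ⟨s, X, ε, s', β⟩ := a
  have hB : 1 ≤ B := (Fin.pos s).trans_le hn
  have hε : ε.toList.length ≤ B := by cases ε <;> simp; exact hB
  have hlen := length_nums_tableList t
  have hcode : (finProdFinEquiv (s, X) : ℕ) = X + p * s := rfl
  have hread : ε.toList.map (symbolCode ∘ (Symbol.terminal : Unit → Symbol Unit (Fin (n * p)))) =
      List.replicate ε.toList.length 0 := by cases ε <;> rfl
  have hnums : nums (List.replicate ε.toList.length 0) =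
      List.replicate ε.toList.length .comma := by cases ε <;> rfl
  simp only [actionRow, ruleRow, PDA.popRule, hcode, nums_cons, List.append_assoc,
    List.cons_append, List.reverse_append, List.reverse_cons, List.reverse_nil, List.nil_append,
    List.map_append, List.map_map, nums_append, hread, hnums, List.reverse_replicate]
  -- the source and the popped symbol, each of them with a copy for the update in the end
  refine (exec_readNum (fun j => rowMem h c t l b o j 0 j) (s.isLt.le.trans hn) _ b
    fun j _ l' b' => (exec_push (m' := rowMem h c t l' b' o j 0 (j + 1))).seq exec_push).seq ?_
  refine (exec_readNum (fun j => { rowMem h c t l b o s j s with y := j }) (X.isLt.le.trans hp) _ _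
    fun j _ l' b' => (exec_push (m' := { rowMem h c t l' b' o s j s with y := j + 1 })).seq
      exec_push).seq ?_
  refine (exec_writeCode hn hp (rowMem h c t _ _ [] s X 0) t o s X).seq ?_
  refine (exec_push (m' := { (rowMem h c t _ _ (.comma :: (List.replicate (X + p * s) .one ++ o))
    s X 0).atEntry (tableList t) (X + p * s) with y := 0 })).seq ?_
  refine (exec_restoreTable (hlen.trans hT) (rowMem h c t _ _
    (.comma :: (List.replicate (X + p * s) .one ++ o)) s X 0)).seq ?_
  -- the number of letters read, `0` or `1`: each letter has the code `0`, written as a comma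
  refine (exec_readNum (fun j => rowMem h c t l b
    (List.replicate j .comma ++ .comma :: (List.replicate (X + p * s) .one ++ o)) s X 0)
    hε _ _ fun j _ l' b' => exec_push (k := .out) (a := .comma)).seq ?_
  -- the target and the pushed word
  refine (exec_readNum (fun j => rowMem h c t l b
    (List.replicate ε.toList.length .comma ++ .comma :: (List.replicate (X + p * s) .one ++ o))
    s X j) (s'.isLt.le.trans hn) _ _ fun j _ l' b' => exec_push (k := .r) (a := .one)).seq ?_
  refine (exec_popItems hn hp hT h c t l s X β ha _ _ s').seq ?_
  exact (exec_move (m' := rowMem h c t _ _ _ _ _ _)).seq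
    ((exec_push (m' := rowMem h c t _ _ _ _ _ _)).seq
      (exec_writeEntry hn hp hT h c t _ _ _ s (PDA.evalTable t s' β) X))

end Row

/-! ### The rounds of the iteration -/

/-- One round: discard the rules written so far, process all actions and restore the input. -/
def processRound : StackProg Reg Letter :=
  clear .out ;; loop .io Option.isSome processRow ;; pour .bak .io

section Rounds

variable {n p B : ℕ}

/-- The rules that are written in a round which starts with the table `t`. -/
def encodeRules (t : Fin n × Fin p → Fin n) (δ : List (PDAAction (Fin n) Unit (Fin p))) :
    List Letter :=
  encodeTable ((PDA.popRules finProdFinEquiv t δ).map ruleRow)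

theorem exec_processRows (hn : n ≤ B) (hp : p ≤ B) (hT : n * p * n ≤ B) (h : List Letter) (c : ℕ)
    (δ : List (PDAAction (Fin n) Unit (Fin p))) (hδ : δ.length ≤ B)
    (ha : ∀ a ∈ δ, a.push.length ≤ B) (t : Fin n × Fin p → Fin n) (b o : List Letter) :
    Exec B (loop .io Option.isSome processRow)
      (rowMem h c t (encodeTable (δ.map actionRow)) b o 0 0 0)
      (rowMem h c (PDA.tableRound δ t) [] ((encodeTable (δ.map actionRow)).reverse ++ b)
        ((encodeRules t δ).reverse ++ o) 0 0 0) := by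
  refine ⟨δ.length, hδ, ?_⟩
  clear hδ
  induction δ generalizing t b o with
  | nil => exact ⟨by simp [Mem.stk, rowMem, encodeTable], rfl⟩
  | cons a δ ih =>
    have h₁ := ih (fun a' ha' => ha a' (List.mem_cons_of_mem a ha')) (PDA.updateTable t a)
      ((nums (actionRow a) ++ [Letter.semi]).reverse ++ b)
      ((nums (ruleRow (PDA.popRule finProdFinEquiv t a)) ++ [Letter.semi]).reverse ++ o)
    have h₂ := exec_processRow hn hp hT h c t (encodeTable (δ.map actionRow)) b o a
      (ha a List.mem_cons_self)
    have e : PDA.tableRound (a :: δ) t = PDA.tableRound δ (PDA.updateTable t a) := rfl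
    simp only [List.map_cons, encodeTable_cons, encodeRules, PDA.popRules, e, List.reverse_append,
      List.reverse_cons, List.append_assoc, List.cons_append, List.nil_append,
      List.reverse_nil] at h₁ h₂ ⊢
    refine ⟨?_, _, h₂, h₁⟩
    simp [Mem.stk, rowMem]

theorem exec_processRound (hn : n ≤ B) (hp : p ≤ B) (hT : n * p * n ≤ B) (h : List Letter) (c : ℕ)
    (δ : List (PDAAction (Fin n) Unit (Fin p))) (hδ : δ.length ≤ B)
    (ha : ∀ a ∈ δ, a.push.length ≤ B) (hE : (encodeTable (δ.map actionRow)).length ≤ B)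
    (t : Fin n × Fin p → Fin n) (o : List Letter) (ho : o.length ≤ B) :
    Exec B processRound (rowMem h c t (encodeTable (δ.map actionRow)) [] o 0 0 0)
      (rowMem h c (PDA.tableRound δ t) (encodeTable (δ.map actionRow)) []
        (encodeRules t δ).reverse 0 0 0) := by
  refine (exec_clear (m' := rowMem h c t (encodeTable (δ.map actionRow)) [] [] 0 0 0) ho).seq
    ((exec_processRows hn hp hT h c δ hδ ha t [] []).seq (exec_pour (by decide) ?_ ?_))
  · simpa [Mem.stk, rowMem] using hE
  · funext j
    cases j <;> simp [Mem.stk, rowMem]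

/-- With `c + 1` rounds, the rules that remain are those of the last round, which starts with the
table obtained in `c` rounds. -/
theorem exec_processRounds (hn : n ≤ B) (hp : p ≤ B) (hT : n * p * n ≤ B) (h : List Letter)
    (δ : List (PDAAction (Fin n) Unit (Fin p))) (hδ : δ.length ≤ B)
    (ha : ∀ a ∈ δ, a.push.length ≤ B) (hE : (encodeTable (δ.map actionRow)).length ≤ B)
    (ho : ∀ t, (encodeRules t δ).length ≤ B) (t : Fin n × Fin p → Fin n) (c : ℕ)
    (hc : c + 1 ≤ B) :
    Exec B (whileOne .cnt (pop .cnt ;; processRound))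
      (rowMem h (c + 1) t (encodeTable (δ.map actionRow)) [] [] 0 0 0)
      (rowMem h 0 ((PDA.tableRound δ)^[c + 1] t) (encodeTable (δ.map actionRow)) []
        (encodeRules ((PDA.tableRound δ)^[c] t) δ).reverse 0 0 0) := by
  refine exec_whileOne (k := .cnt) [] (by simp) (fun j v => rowMem h v ((PDA.tableRound δ)^[j] t)
    (encodeTable (δ.map actionRow)) []
    (j.casesOn [] fun j => (encodeRules ((PDA.tableRound δ)^[j] t) δ).reverse) 0 0 0) hc
    (fun j v => (List.append_nil _).symm) fun j v hj => ?_
  refine (exec_pop (m' := rowMem h v _ _ _ _ 0 0 0)).seq ?_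
  rw [Function.iterate_succ_apply']
  refine exec_processRound hn hp hT h v δ hδ ha hE _ _ ?_
  cases j
  · exact Nat.zero_le B
  · simpa using ho _

end Rounds

/-! ### The header and the whole program -/

/-- Remove a number from the input, and do `c` as many times as the number says. -/
def takeNum (c : StackProg Reg Letter) : StackProg Reg Letter :=
  whileOne .io (pop .io ;; c) ;; pop .io

theorem exec_takeNum {B : ℕ} {c : StackProg Reg Letter} (μ : ℕ → Mem) {v : ℕ} (hv : v ≤ B)
    (l : List Letter)
    (hc : ∀ j < v, ∀ l, Exec B c { μ j with io := l } { μ (j + 1) with io := l }) :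
    Exec B (takeNum c) { μ 0 with io := List.replicate v .one ++ .comma :: l }
      { μ v with io := l } :=
  (exec_whileOne (.comma :: l) (by simp)
    (fun j i => { μ j with io := List.replicate i .one ++ .comma :: l }) hv (fun _ _ => rfl)
    fun j i hi => (exec_pop (m' := { μ j with
      io := List.replicate i .one ++ .comma :: l })).seq (hc j (by omega) _)).seq exec_pop

/-- Read the header of the input, write the header of the output, and initialize the table and the
number of rounds. -/
def processHeader : StackProg Reg Letter :=
  takeNum (push .r .one) ;; takeNum (push .p .one) ;;
  eachCode .r .y (push .hdr .one ;; push .tab .comma ;; push .cnt .one) ;;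
  push .hdr .comma ;; push .cnt .one ;;
  takeNum (push .r .one) ;; takeNum (push .y .one) ;; eachCode .r .y (push .hdr .one) ;;
  push .hdr .comma ;; push .hdr .semi ;; pop .io

/-- Empty the memory, and write the output. -/
def finish : StackProg Reg Letter :=
  clear .io ;; clear .tab ;; clear .p ;; pour .out .io ;; pour .hdr .io

/-- The program that converts automata into grammars. -/
def convertProg : StackProg Reg Letter :=
  processHeader ;; whileOne .cnt (pop .cnt ;; processRound) ;; finish

theorem nums_tableList_initTable (P : UDPDA) : nums (tableList P.initTable) =
    List.replicate (P.numStates * P.numSymbols) .comma := by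
  have h : tableList P.initTable = List.replicate (P.numStates * P.numSymbols) 0 := by
    simp [tableList, UDPDA.initTable, List.ofFn_const]
  rw [h]
  generalize P.numStates * P.numSymbols = k
  induction k with
  | zero => rfl
  | succ k ih => rw [List.replicate_succ, nums_cons, ih]; rfl

theorem exec_processHeader (P : UDPDA) {B : ℕ} (hn : P.numStates ≤ B) (hp : P.numSymbols ≤ B)
    (l : List Letter) :
    Exec B processHeader
      { io := nums [P.numStates, P.numSymbols, P.initState, P.initSymbol] ++ .semi :: l }
      (rowMem (nums [P.numStates * P.numSymbols, P.toUnaryCFG.start] ++ [Letter.semi]).reverse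
        (P.numStates * P.numSymbols + 1) P.initTable l [] [] 0 0 0) := by
  have hs : (P.toUnaryCFG.start : ℕ) = P.initSymbol + P.numSymbols * P.initState := rfl
  obtain ⟨N, hN⟩ : ∃ N, N = 0 + P.numSymbols * P.numStates := ⟨_, rfl⟩
  have hN' : P.numStates * P.numSymbols = N := by rw [hN, Nat.zero_add, Nat.mul_comm]
  rw [rowMem, nums_tableList_initTable]
  simp only [nums_cons, hs, hN', List.append_assoc, List.cons_append]
  refine (exec_takeNum (fun j => { r := j }) hn _ fun _ _ _ => exec_push (k := .r) (a := .one)).seq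
    ?_
  refine (exec_takeNum (fun j => { r := P.numStates, p := j }) hp _ fun _ _ _ =>
    exec_push (k := .p) (a := .one)).seq ?_
  refine (exec_eachCode_r_y (y := 0) (fun j => {
    io := _, hdr := List.replicate j .one, tab := List.replicate j .comma, cnt := j }) hp hn
    (Nat.zero_le B) fun j _ a b v w => (exec_push (m' := {
      io := _, hdr := List.replicate (j + 1) .one, tab := List.replicate j .comma,
      p := a, p₂ := b, r := v, y := w, cnt := j })).seq ((exec_push (m' := {
      io := _, hdr := List.replicate (j + 1) .one, tab := List.replicate (j + 1) .comma,
      p := a, p₂ := b, r := v, y := w, cnt := j })).seq exec_push)).seq ?_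
  rw [← hN]
  refine (exec_push (m' := {
    io := _, hdr := .comma :: List.replicate N .one,
    tab := List.replicate N .comma, p := P.numSymbols, cnt := N })).seq ?_
  refine (exec_push (m' := {
    io := _, hdr := .comma :: List.replicate N .one,
    tab := List.replicate N .comma, p := P.numSymbols, cnt := N + 1 })).seq ?_
  refine (exec_takeNum (fun j => {
    hdr := .comma :: List.replicate N .one,
    tab := List.replicate N .comma, p := P.numSymbols, cnt := N + 1, r := j })
    (P.initState.isLt.le.trans hn) _ fun _ _ _ => exec_push (k := .r) (a := .one)).seq ?_
  refine (exec_takeNum (fun j => {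
    hdr := .comma :: List.replicate N .one,
    tab := List.replicate N .comma, p := P.numSymbols, cnt := N + 1, r := P.initState, y := j })
    (P.initSymbol.isLt.le.trans hp) _ fun _ _ _ => exec_push (k := .y) (a := .one)).seq ?_
  refine (exec_eachCode_r_y (fun j => {
    io := .semi :: l,
    hdr := List.replicate j .one ++ .comma :: List.replicate N .one,
    tab := List.replicate N .comma, cnt := N + 1 }) hp (P.initState.isLt.le.trans hn)
    (P.initSymbol.isLt.le.trans hp) fun _ _ _ _ _ _ => exec_push (k := .hdr) (a := .one)).seq ?_
  refine (exec_push (m' := {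
    io := .semi :: l, hdr := .comma ::
    (List.replicate (P.initSymbol + P.numSymbols * P.initState) .one ++
      .comma :: List.replicate N .one),
    tab := List.replicate N .comma, p := P.numSymbols, cnt := N + 1 })).seq ?_
  refine (exec_push (m' := {
    io := .semi :: l, hdr := .semi :: .comma ::
    (List.replicate (P.initSymbol + P.numSymbols * P.initState) .one ++
      .comma :: List.replicate N .one),
    tab := List.replicate N .comma, p := P.numSymbols, cnt := N + 1 })).seq (exec_pop ?_)
  funext j
  cases j <;> simp [Mem.stk, nums]

theorem exec_finish {n p B : ℕ} (hp : p ≤ B) (hT : n * p * n ≤ B) (h : List Letter)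
    (hh : h.length ≤ B) (t : Fin n × Fin p → Fin n) (l : List Letter) (hl : l.length ≤ B)
    (o : List Letter) (ho : o.length ≤ B) :
    Exec B finish (rowMem h 0 t l [] o 0 0 0) { io := h.reverse ++ o.reverse } := by
  refine (exec_clear (m' := rowMem h 0 t [] [] o 0 0 0) hl).seq ?_
  refine (exec_clear (m' := { hdr := h, out := o, p := p })
    ((length_nums_tableList t).trans hT)).seq ?_
  refine (exec_clear (m' := { hdr := h, out := o }) (by simpa [Mem.stk] using hp)).seq ?_
  refine (exec_pour (m' := { hdr := h, io := o.reverse }) (by decide) ho ?_).seq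
    (exec_pour (by decide) hh)
  funext j
  cases j <;> simp [Mem.stk]

/-! ### The bound for the loops -/

theorem length_le_length_encodeTable (t : List (List ℕ)) : t.length ≤ (encodeTable t).length := by
  induction t with
  | nil => exact Nat.zero_le _
  | cons l t ih =>
    rw [encodeTable_cons]
    simp only [List.length_append, List.length_cons]
    omega

theorem length_le_length_nums (l : List ℕ) : l.length ≤ (nums l).length := by
  induction l with
  | nil => exact Nat.zero_le _
  | cons k l ih =>
    rw [nums_cons]
    simp only [List.length_append, List.length_cons]
    omega

theorem length_le_of_mem_table {t : List (List ℕ)} {l : List ℕ} (hl : l ∈ t) :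
    l.length ≤ (encodeTable t).length := by
  induction t with
  | nil => simp at hl
  | cons k t ih =>
    rw [encodeTable_cons]
    simp only [List.length_append, List.length_cons]
    rcases List.mem_cons.1 hl with rfl | hl
    · have := length_le_length_nums l
      omega
    · have := ih hl
      omega

theorem symbolCode_lt {v : ℕ} (s : Symbol Unit (Fin v)) : symbolCode s < v + 1 := by
  cases s with
  | terminal => exact Nat.succ_pos v
  | nonterminal i => exact Nat.succ_lt_succ i.isLt

theorem length_nums_ruleRow {v : ℕ} (ρ : ContextFreeRule Unit (Fin v)) :
    (nums (ruleRow ρ)).length ≤ (ρ.output.length + 1) * (v + 1) := by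
  refine (length_nums_le (n := v + 1) fun k hk => ?_).trans_eq (by simp [ruleRow])
  rcases List.mem_cons.1 hk with rfl | hk
  · exact ρ.input.isLt.trans (Nat.lt_succ_self v)
  · obtain ⟨s, -, rfl⟩ := List.mem_map.1 hk
    exact symbolCode_lt s

theorem length_popSymbols {Q T Γ V : Type} (code : Q × Γ → V) (t : Q × Γ → Q) (β : List Γ) :
    ∀ q, (PDA.popSymbols (T := T) code t q β).length = β.length := by
  induction β with
  | nil => exact fun q => rfl
  | cons X β ih => exact fun q => congrArg Nat.succ (ih _)

/-- Each symbol of the rule for an action is a number of at most `n * p`, and there are fewer of them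
than numbers in the row of the action. -/
theorem length_encodeRules {n p : ℕ} (δ : List (PDAAction (Fin n) Unit (Fin p))) :
    ∀ t : Fin n × Fin p → Fin n,
      (encodeRules t δ).length ≤ (n * p + 2) * (encodeTable (δ.map actionRow)).length := by
  induction δ with
  | nil => exact fun t => Nat.zero_le _
  | cons a δ ih =>
    intro t
    have h₁ := ih (PDA.updateTable t a)
    have h₂ : (nums (ruleRow (PDA.popRule finProdFinEquiv t a))).length ≤
        (a.read.toList.length + a.push.length + 1) * (n * p + 1) := by
      simpa [PDA.popRule, length_popSymbols] using
        length_nums_ruleRow (PDA.popRule finProdFinEquiv t a)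
    have h₃ := length_le_length_nums (actionRow a)
    have h₃' : (actionRow a).length = a.push.length + 4 := by simp [actionRow]
    have h₄ : a.read.toList.length ≤ 1 := by cases a.read <;> simp
    have h₅ := h₂.trans (Nat.mul_le_mul_right (n * p + 1)
      (show _ ≤ (nums (actionRow a)).length by omega))
    simp only [encodeRules, PDA.popRules, List.map_cons, encodeTable_cons, List.length_append,
      List.length_cons] at h₁ ⊢
    nlinarith

theorem length_encode (P : UDPDA) : P.encode.length = P.numStates + P.numSymbols + P.initState +
    P.initSymbol + 5 + (encodeTable (P.actions.map actionRow)).length := by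
  have h : P.encode = nums [P.numStates, P.numSymbols, P.initState, P.initSymbol] ++
      .semi :: encodeTable (P.actions.map actionRow) := encodeTable_cons _ _
  rw [h]
  simp [nums]
  omega

/-- All loops of the program are bounded by a cubic polynomial in the length of the input. -/
theorem exec_convertProg (P : UDPDA) :
    Exec ((P.encode.length + 2) ^ 3) convertProg { io := P.encode }
      { io := P.toUnaryCFG.encode } := by
  have hN := length_encode P
  have h_in : P.encode = nums [P.numStates, P.numSymbols, P.initState, P.initSymbol] ++
      .semi :: encodeTable (P.actions.map actionRow) := encodeTable_cons _ _
  have h_out : P.toUnaryCFG.encode =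
      nums [P.numStates * P.numSymbols, P.toUnaryCFG.start] ++ .semi :: encodeRules
        ((PDA.tableRound P.actions)^[P.numStates * P.numSymbols] P.initTable) P.actions :=
    encodeTable_cons _ _
  have hs : (P.toUnaryCFG.start : ℕ) < P.numStates * P.numSymbols := P.toUnaryCFG.start.isLt
  generalize P.encode.length = N at hN
  have hδ := length_le_length_encodeTable (P.actions.map actionRow)
  have ha : ∀ a ∈ P.actions, a.push.length ≤ (encodeTable (P.actions.map actionRow)).length := by
    intro a ha
    refine le_trans ?_ (length_le_of_mem_table (List.mem_map_of_mem (f := actionRow) ha))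
    simp only [actionRow, List.length_cons, List.length_map]
    omega
  rw [h_in, h_out]
  set E := encodeTable (P.actions.map actionRow)
  have ho : ∀ t, (encodeRules t P.actions).length ≤
      (P.numStates * P.numSymbols + 2) * E.length := length_encodeRules P.actions
  rw [List.length_map] at hδ
  have hnp : P.numStates * P.numSymbols ≤ N * N := Nat.mul_le_mul (by omega) (by omega)
  have hT : P.numStates * P.numSymbols * P.numStates ≤ N * N * N := Nat.mul_le_mul hnp (by omega)
  have hO : (P.numStates * P.numSymbols + 2) * E.length ≤ (N * N + 2) * N :=
    Nat.mul_le_mul (by omega) (by omega)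
  have hB : (N + 2) ^ 3 = N * N * N + 6 * (N * N) + 12 * N + 8 := by ring
  rw [Nat.add_mul, Nat.add_mul] at hO
  have hlen : (nums [P.numStates * P.numSymbols, P.toUnaryCFG.start] ++ [Letter.semi]).reverse.length
      ≤ (N + 2) ^ 3 := by
    simp [nums]
    omega
  have ho' : ∀ t, (encodeRules t P.actions).length ≤ (N + 2) ^ 3 := by
    intro t
    have := ho t
    rw [Nat.add_mul] at this
    omega
  refine (exec_processHeader P (by omega) (by omega) E).seq ((exec_processRounds (by omega)
    (by omega) (by omega) _ P.actions (by omega) (fun a h => (ha a h).trans (by omega))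
    (show E.length ≤ _ by omega) ho' P.initTable _ (by omega)).seq ?_)
  have h := exec_finish (n := P.numStates) (p := P.numSymbols) (B := (N + 2) ^ 3) (by omega)
    (by omega) _ hlen
    ((PDA.tableRound P.actions)^[P.numStates * P.numSymbols + 1] P.initTable) E (by omega)
    (encodeRules ((PDA.tableRound P.actions)^[P.numStates * P.numSymbols] P.initTable)
      P.actions).reverse (by rw [List.length_reverse]; exact ho' _)
  simpa only [List.reverse_reverse, List.append_assoc, List.cons_append, List.nil_append] using h

end UDPDAConverter

/-- There is one algorithm (a Turing machine running in time polynomial in the length of the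
description of its input) that turns every unary deterministic pushdown automaton with `n` states
and `p` stack symbols into a context-free grammar with at most `n * p` variables for the language
that the automaton accepts by empty stack. -/
theorem theorem3 :
    ∃ convert : UDPDA → UnaryCFG,
      Nonempty (Turing.TM2ComputableInPolyTime UDPDA.encode UnaryCFG.encode convert) ∧
      ∀ P : UDPDA,
        (convert P).toCFG.language = P.toPDA.language ∧
        (convert P).numVars ≤ P.numStates * P.numSymbols := by
  refine ⟨UDPDA.toUnaryCFG, ?_, fun P => ⟨P.toUnaryCFG_language, le_rfl⟩⟩
  have hstk : ∀ l : List Letter, ({ io := l } : UDPDAConverter.Mem).stk =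
      Function.update (fun _ => []) .io l := by
    intro l
    funext j
    cases j <;> rfl
  refine StackProg.polyTime_of_runs UDPDAConverter.convertProg .io ((Polynomial.X + 2) ^ 3)
    fun P => ?_
  rw [← hstk, ← hstk]
  simp only [Polynomial.eval_pow, Polynomial.eval_add, Polynomial.eval_X, Polynomial.eval_ofNat]
  exact UDPDAConverter.exec_convertProg P
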